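/- **Setting.** Inner products are linear in the second variable. For a unital $*$-algebra, a *$\mathbb Z_2$-grading* is an involutive $*$-automorphism $\gamma$; elements with $\gamma(a)=a$ have degree $\partial a=0$ and elements with $\gamma(a)=-a$ have degree $\partial a=1$. A *state* on a unital $*$-algebra $\mathcal C$ is a linear functional $\omega$ with $\omega(1)=1$ and $\omega(c^*c)\ge 0$ for all $c\in\mathcal C$. *Normal* means $\sigma$-weakly continuous, and a *channel* is a unital completely positive linear map. Let $\mathcal A$ and $\mathcal B$ be von Neumann algebras with $\mathbb Z_2$-gradings $\gamma_{\mathcal A}$ and $\gamma_{\mathcal B}$, and let $\mu$, $\nu$ be faithful normal states on $\mathcal A$, $\mathcal B$ that are even, i.e. $\mu\circ\gamma_{\mathcal A}=\mu$ and $\nu\circ\gamma_{\mathcal B}=\nu$. Let $\mathcal B\subset B(\mathcal G)$ be in standard form, that is, there are given a conjugate linear $J$ on $\mathcal G$ with $J^2=1$, $J^*=J$ and $J\mathcal BJ=\mathcal B'$, and a closed convex cone $\mathcal P\subset\mathcal G$, such that $Jx=x$ for $x\in\mathcal P$, an element of $\mathcal P$ is cyclic for $\mathcal B$ if and only if it is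 separating, and every normal state on $\mathcal B$ is of the form $\langle\xi,\cdot\,\xi\rangle$ for a unique $\xi\in\mathcal P$. Let $\Lambda_\nu\in\mathcal P$ be the vector with $\nu(b)=\langle\Lambda_\nu,b\Lambda_\nu\rangle$, and let $g$ be the self-adjoint unitary on $\mathcal G$ determined by $g\,b\Lambda_\nu=\gamma_{\mathcal B}(b)\Lambda_\nu$ for $b\in\mathcal B$. Put $$g^{\pm1/2}=\tfrac12(1+g)\mp\tfrac i2(1-g),\qquad \mathcal B^\wr=g^{1/2}\mathcal B'g^{-1/2},\qquad \gamma_{\mathcal B}^{1/2}:\mathcal B'\to\mathcal B^\wr,\ b'\mapsto g^{1/2}b'g^{-1/2}.$$ The gradings of $\mathcal B'$ and of the twisted commutant $\mathcal B^\wr$ are $\gamma_{\mathcal B'}=g(\cdot)g$ and $\gamma_{\mathcal B^\wr}=g(\cdot)g$, and $\nu'$, $\nu^\wr$ are the restrictions of $\langle\Lambda_\nu,\cdot\,\Lambda_\nu\rangle$ to $\mathcal B'$, $\mathcal B^\wr$. $\mathcal A\boxtimes\mathcal B^\wr$ is the algebraic Fermi ($\mathbb Z_2$-graded) tensor product, with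 $(a\boxtimes b)(c\boxtimes d)=(-1)^{\partial b\,\partial c}\,ac\boxtimes bd$ and $(a\boxtimes b)^*=(-1)^{\partial a\,\partial b}\,a^*\boxtimes b^*$ for homogeneous elements, and $\odot$ is the usual algebraic tensor product. A *fermionic transport plan* $\omega\in T^{\mathrm F}(\mu,\nu)$ is a state on $\mathcal A\boxtimes\mathcal B^\wr$ such that, for all $a\in\mathcal A$ and $b\in\mathcal B^\wr$, $$\omega(a\boxtimes 1)=\mu(a),\qquad \omega(1\boxtimes b)=\nu^\wr(b),\qquad \omega(\gamma_{\mathcal A}(a)\boxtimes b)=\omega(a\boxtimes\gamma_{\mathcal B^\wr}(b)).$$ Similarly $T^\gamma(\mu,\nu)$ is the set of states $\omega$ on $\mathcal A\odot\mathcal B'$ with $\omega(a\odot1)=\mu(a)$, $\omega(1\odot b')=\nu'(b')$ and $\omega(\gamma_{\mathcal A}(a)\odot b')=\omega(a\odot\gamma_{\mathcal B'}(b'))$ for all $a\in\mathcal A$, $b'\in\mathcal B'$. The diagonal plans are the linear functionals given by $\delta^{\mathrm F}_\nu(b\boxtimes c)=\langle\Lambda_\nu,bc\Lambda_\nu\rangle$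 on $\mathcal B\boxtimes\mathcal B^\wr$ and $\delta_\nu(b\odot b')=\langle\Lambda_\nu,bb'\Lambda_\nu\rangle$ on $\mathcal B\odot\mathcal B'$. For $\omega\in T^{\mathrm F}(\mu,\nu)$ let $[c]$ denote the class of $c\in\mathcal A\boxtimes\mathcal B^\wr$ modulo $\{c:\omega(c^*c)=0\}$, let $\langle[c],[d]\rangle=\omega(c^*d)$, $\Omega=[1]$, $\pi^0_\omega(c)[d]=[cd]$, $h[c]=[(\gamma_{\mathcal A}\boxtimes\gamma_{\mathcal B^\wr})(c)]$ and $h^{\pm1/2}=\tfrac12(1+h)\mp\tfrac i2(1-h)$. Define a linear functional $\omega_\odot$ on $\mathcal A\odot\mathcal B'$ by $$\omega_\odot(a\odot b')=\big\langle\Omega,\ \pi^0_\omega(a\boxtimes 1)\,h^{-1/2}\,\pi^0_\omega\big(1\boxtimes\gamma^{1/2}_{\mathcal B}(b')\big)\,h^{1/2}\,\Omega\big\rangle .$$ **Corollary 5.9.** Let $\omega\in T^{\mathrm F}(\mu,\nu)$. There is a uniquely determined function $E_\omega:\mathcal A\to\mathcal B$ such that $\omega(a\boxtimes b)=\delta^{\mathrm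 F}_\nu(E_\omega(a)\boxtimes b)$ for all $a\in\mathcal A$, $b\in\mathcal B^\wr$, that is, $$\omega=\delta^{\mathrm F}_\nu\circ(E_\omega\boxtimes\mathrm{id}_{\mathcal B^\wr}).$$ This $E_\omega$ is a normal channel, it is even, i.e. $E_\omega\circ\gamma_{\mathcal A}=\gamma_{\mathcal B}\circ E_\omega$, and $\nu\circ E_\omega=\mu$. Moreover $\omega_\odot\in T^\gamma(\mu,\nu)$, and $E_\omega=E_{\omega_\odot}$, where $E_{\omega_\odot}$ is the unique function $\mathcal A\to\mathcal B$ with $\omega_\odot=\delta_\nu\circ(E_{\omega_\odot}\odot\mathrm{id}_{\mathcal B'})$. -/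

import Mathlib

open scoped TensorProduct ComplexOrder InnerProductSpace Topology

namespace FermiOT

/-! ### Gradings and the algebraic Fermi tensor product -/

/-- A `ℤ₂`-grading of a unital `*`-algebra: an involutive `*`-automorphism. -/
structure Grading (X : Type*) [Ring X] [StarRing X] [Algebra ℂ X] where
  /-- the automorphism -/
  aut : X ≃⋆ₐ[ℂ] X
  involutive : ∀ x, aut (aut x) = x

namespace Grading

variable {X : Type*} [Ring X] [StarRing X] [Algebra ℂ X] (γ : Grading X)

/-- The grading automorphism as a linear map. -/
def lin : X →ₗ[ℂ] X where
  toFun := γ.aut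
  map_add' := map_add γ.aut
  map_smul' := map_smul γ.aut

@[simp] lemma lin_apply (x : X) : γ.lin x = γ.aut x := rfl

/-- The projection `x ↦ (x + γ x) / 2` onto the even part. -/
noncomputable def evenPart : X →ₗ[ℂ] X := (2⁻¹ : ℂ) • (LinearMap.id + γ.lin)

/-- The projection `x ↦ (x - γ x) / 2` onto the odd part. -/
noncomputable def oddPart : X →ₗ[ℂ] X := (2⁻¹ : ℂ) • (LinearMap.id - γ.lin)

/-- The homogeneous subspaces `{x | γ x = x}` (degree `0`) and `{x | γ x = -x}` (degree `1`). -/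
def part (i : ZMod 2) : Submodule ℂ X where
  carrier := {x | γ.aut x = (-1 : ℂ) ^ i.val • x}
  add_mem' {x y} hx hy := by
    change γ.aut (x + y) = _
    rw [map_add, smul_add, show γ.aut x = _ from hx, show γ.aut y = _ from hy]
  zero_mem' := by simp
  smul_mem' c x hx := by
    change γ.aut (c • x) = _
    rw [map_smul, show γ.aut x = _ from hx, smul_comm]

lemma mem_part {i : ZMod 2} {x : X} : x ∈ γ.part i ↔ γ.aut x = (-1 : ℂ) ^ i.val • x := Iff.rfl

lemma mem_part_zero {x : X} : x ∈ γ.part 0 ↔ γ.aut x = x := by simp [mem_part]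

lemma mem_part_one {x : X} : x ∈ γ.part 1 ↔ γ.aut x = -x := by simp [mem_part, ZMod.val_one]

lemma evenPart_mem (x : X) : γ.evenPart x ∈ γ.part 0 := by
  rw [mem_part_zero]; simp [evenPart, γ.involutive, add_comm]

lemma oddPart_mem (x : X) : γ.oddPart x ∈ γ.part 1 := by
  rw [mem_part_one]; simp [oddPart, γ.involutive, ← smul_neg]

lemma evenPart_add_oddPart (x : X) : γ.evenPart x + γ.oddPart x = x := by
  simp only [evenPart, oddPart, LinearMap.smul_apply, LinearMap.add_apply, LinearMap.id_apply,
    LinearMap.sub_apply, ← smul_add]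
  rw [show x + γ.lin x + (x - γ.lin x) = (2 : ℂ) • x by rw [two_smul]; abel, smul_smul]
  norm_num

lemma evenPart_of_mem_zero {x : X} (hx : x ∈ γ.part 0) : γ.evenPart x = x := by
  rw [mem_part_zero] at hx
  simp only [evenPart, LinearMap.smul_apply, LinearMap.add_apply, LinearMap.id_apply, lin_apply, hx]
  rw [← two_smul ℂ x, smul_smul]; norm_num

lemma evenPart_of_mem_one {x : X} (hx : x ∈ γ.part 1) : γ.evenPart x = 0 := by
  rw [mem_part_one] at hx
  simp [evenPart, hx]

lemma oddPart_of_mem_zero {x : X} (hx : x ∈ γ.part 0) : γ.oddPart x = 0 := by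
  rw [mem_part_zero] at hx
  simp [oddPart, hx]

lemma oddPart_of_mem_one {x : X} (hx : x ∈ γ.part 1) : γ.oddPart x = x := by
  have := γ.evenPart_add_oddPart x
  rwa [γ.evenPart_of_mem_one hx, zero_add] at this

instance : SetLike.GradedMonoid γ.part where
  one_mem := by rw [mem_part_zero]; exact map_one γ.aut
  mul_mem i j x y hx hy := by
    rw [mem_part] at *
    rw [map_mul, hx, hy, smul_mul_smul_comm, ← pow_add, ZMod.val_add,
      ← neg_one_pow_eq_pow_mod_two]

/-- The decomposition of an element into its even and odd parts. -/
noncomputable def decomposeLin : X →ₗ[ℂ] DirectSum (ZMod 2) (fun i => γ.part i) :=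
  (DirectSum.lof ℂ (ZMod 2) (fun i => γ.part i) 0) ∘ₗ
      γ.evenPart.codRestrict (γ.part 0) γ.evenPart_mem +
    (DirectSum.lof ℂ (ZMod 2) (fun i => γ.part i) 1) ∘ₗ
      γ.oddPart.codRestrict (γ.part 1) γ.oddPart_mem

noncomputable instance : DirectSum.Decomposition γ.part :=
  DirectSum.Decomposition.ofLinearMap γ.part γ.decomposeLin
    (by
      ext x
      simp [decomposeLin, γ.evenPart_add_oddPart])
    (by
      ext i x : 2
      obtain ⟨x, hx⟩ := x
      have hcases : ∀ j : ZMod 2, j = 0 ∨ j = 1 := by decide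
      rcases hcases i with rfl | rfl
      · have h0 : γ.evenPart.codRestrict (γ.part 0) γ.evenPart_mem x = ⟨x, hx⟩ :=
          Subtype.ext (γ.evenPart_of_mem_zero hx)
        have h1 : γ.oddPart.codRestrict (γ.part 1) γ.oddPart_mem x = 0 :=
          Subtype.ext (γ.oddPart_of_mem_zero hx)
        simp [decomposeLin, h0, h1]
      · have h0 : γ.evenPart.codRestrict (γ.part 0) γ.evenPart_mem x = 0 :=
          Subtype.ext (γ.evenPart_of_mem_one hx)
        have h1 : γ.oddPart.codRestrict (γ.part 1) γ.oddPart_mem x = ⟨x, hx⟩ :=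
          Subtype.ext (γ.oddPart_of_mem_one hx)
        simp [decomposeLin, h0, h1])

noncomputable instance : GradedAlgebra γ.part where

end Grading

section FermiTensor

open GradedTensorProduct

variable {X Y : Type*} [Ring X] [StarRing X] [Algebra ℂ X] [StarModule ℂ X]
  [Ring Y] [StarRing Y] [Algebra ℂ Y] [StarModule ℂ Y]

/-- The algebraic Fermi tensor product: the `ℤ₂`-graded tensor product, with multiplication
`(a ⊠ b)(c ⊠ d) = (-1)^(∂b ∂c) ac ⊠ bd` on homogeneous elements. -/
abbrev Fermi (γ : Grading X) (η : Grading Y) : Type _ := γ.part ᵍ⊗[ℂ] η.part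

/-- The elementary tensor `a ⊠ b`. -/
noncomputable abbrev ftmul (γ : Grading X) (η : Grading Y) (a : X) (b : Y) : Fermi γ η :=
  GradedTensorProduct.of ℂ γ.part η.part (a ⊗ₜ[ℂ] b)

/-- `S ⊠ T`, given by `(S ⊠ T)(a ⊠ b) = S a ⊠ T b`, for linear maps `S`, `T`. -/
noncomputable def fermiMap {X' Y' : Type*} [Ring X'] [StarRing X'] [Algebra ℂ X']
    [Ring Y'] [StarRing Y'] [Algebra ℂ Y']
    (γ : Grading X) (η : Grading Y) (γ' : Grading X') (η' : Grading Y')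
    (S : X →ₗ[ℂ] X') (T : Y →ₗ[ℂ] Y') : Fermi γ η →ₗ[ℂ] Fermi γ' η' :=
  (GradedTensorProduct.of ℂ γ'.part η'.part).toLinearMap ∘ₗ TensorProduct.map S T ∘ₗ
    (GradedTensorProduct.of ℂ γ.part η.part).symm.toLinearMap

variable (γ : Grading X) (η : Grading Y)

/-- The sign twist `a ⊠ b ↦ (-1)^(∂a ∂b) a ⊠ b`. -/
noncomputable def signTwist : Fermi γ η →ₗ[ℂ] Fermi γ η :=
  fermiMap γ η γ η LinearMap.id η.evenPart + fermiMap γ η γ η γ.lin η.oddPart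

/-- The involution `(a ⊠ b)* = (-1)^(∂a ∂b) a* ⊠ b*` of the Fermi tensor product. -/
noncomputable instance : Star (Fermi γ η) where
  star c := signTwist γ η (GradedTensorProduct.of ℂ γ.part η.part
    (star ((GradedTensorProduct.of ℂ γ.part η.part).symm c)))

lemma fermi_star_add (c d : Fermi γ η) : star (c + d) = star c + star d := by
  change signTwist γ η _ = signTwist γ η _ + signTwist γ η _
  rw [map_add, star_add, map_add, map_add]

lemma Grading.star_mem_part {i : ZMod 2} {x : X} (hx : x ∈ γ.part i) : star x ∈ γ.part i := by
  rw [Grading.mem_part] at *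
  rw [map_star, hx, star_smul]
  simp

lemma fermi_star_ftmul {i j : ZMod 2} {a : X} {b : Y} (ha : a ∈ γ.part i) (hb : b ∈ η.part j) :
    star (ftmul γ η a b) = (-1 : ℤˣ) ^ (i * j) • ftmul γ η (star a) (star b) := by
  have ha' := γ.star_mem_part ha
  have hb' := η.star_mem_part hb
  change GradedTensorProduct.of ℂ γ.part η.part (star a ⊗ₜ[ℂ] η.evenPart (star b)) +
    GradedTensorProduct.of ℂ γ.part η.part (γ.aut (star a) ⊗ₜ[ℂ] η.oddPart (star b)) = _
  have hcases : ∀ j : ZMod 2, j = 0 ∨ j = 1 := by decide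
  rcases hcases j with rfl | rfl
  · rw [η.evenPart_of_mem_zero hb', η.oddPart_of_mem_zero hb']
    simp
  · rw [η.evenPart_of_mem_one hb', η.oddPart_of_mem_one hb']
    rcases hcases i with rfl | rfl
    · rw [γ.mem_part_zero] at ha'
      simp [ha']
    · rw [γ.mem_part_one] at ha'
      simp [ha', TensorProduct.neg_tmul]

set_option linter.unusedSectionVars false in
lemma fermi_induction {P : Fermi γ η → Prop} (hadd : ∀ c d, P c → P d → P (c + d))
    (h : ∀ (i j : ZMod 2) (a : X) (b : Y), a ∈ γ.part i → b ∈ η.part j → P (ftmul γ η a b))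
    (c : Fermi γ η) : P c := by
  have key : ∀ t : X ⊗[ℂ] Y, P (GradedTensorProduct.of ℂ γ.part η.part t) := by
    intro t
    induction t using TensorProduct.induction_on with
    | zero =>
      have h0 := h 0 0 0 0 (zero_mem _) (zero_mem _)
      rwa [ftmul, TensorProduct.zero_tmul] at h0
    | tmul a b =>
      rw [← γ.evenPart_add_oddPart a, ← η.evenPart_add_oddPart b, TensorProduct.add_tmul,
        TensorProduct.tmul_add, TensorProduct.tmul_add, map_add, map_add, map_add]
      exact hadd _ _
        (hadd _ _ (h _ _ _ _ (γ.evenPart_mem a) (η.evenPart_mem b))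
          (h _ _ _ _ (γ.evenPart_mem a) (η.oddPart_mem b)))
        (hadd _ _ (h _ _ _ _ (γ.oddPart_mem a) (η.evenPart_mem b))
          (h _ _ _ _ (γ.oddPart_mem a) (η.oddPart_mem b)))
    | add s t hs ht => rw [map_add]; exact hadd _ _ hs ht
  exact key ((GradedTensorProduct.of ℂ γ.part η.part).symm c)

lemma fermi_star_smul (u : ℤˣ) (c : Fermi γ η) : star (u • c) = u • star c := by
  have hneg : star (-c) = -star c := by
    have h0 : star (0 : Fermi γ η) = 0 := by
      have := fermi_star_add γ η 0 0
      simpa using this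
    have := fermi_star_add γ η c (-c)
    rw [add_neg_cancel, h0] at this
    exact (neg_eq_of_add_eq_zero_right this.symm).symm
  rcases Int.units_eq_one_or u with rfl | rfl
  · simp
  · simpa using hneg

set_option linter.unusedSectionVars false in
lemma ftmul_mul_ftmul {j i : ZMod 2} (a : X) {b : Y} {c : X} (d : Y)
    (hb : b ∈ η.part j) (hc : c ∈ γ.part i) :
    ftmul γ η a b * ftmul γ η c d = (-1 : ℤˣ) ^ (j * i) • ftmul γ η (a * c) (b * d) :=
  tmul_coe_mul_coe_tmul γ.part η.part a ⟨b, hb⟩ ⟨c, hc⟩ d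

noncomputable instance : StarRing (Fermi γ η) where
  star_add := fermi_star_add γ η
  star_involutive c := by
    induction c using fermi_induction γ η with
    | hadd c d hc hd => rw [fermi_star_add, fermi_star_add, hc, hd]
    | h i j a b ha hb =>
      rw [fermi_star_ftmul γ η ha hb, fermi_star_smul,
        fermi_star_ftmul γ η (γ.star_mem_part ha) (η.star_mem_part hb), star_star, star_star,
        smul_smul, Int.units_mul_self, one_smul]
  star_mul c d := by
    induction c using fermi_induction γ η with
    | hadd c c' hc hc' => rw [add_mul, fermi_star_add, fermi_star_add, hc, hc', mul_add]
    | h i j a b ha hb =>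
      induction d using fermi_induction γ η with
      | hadd d d' hd hd' => rw [mul_add, fermi_star_add, fermi_star_add, hd, hd', add_mul]
      | h k l c d hc hd =>
        rw [ftmul_mul_ftmul γ η a d hb hc, fermi_star_smul,
          fermi_star_ftmul γ η (SetLike.mul_mem_graded ha hc) (SetLike.mul_mem_graded hb hd),
          fermi_star_ftmul γ η ha hb, fermi_star_ftmul γ η hc hd, smul_mul_smul_comm,
          ftmul_mul_ftmul γ η _ _ (η.star_mem_part hd) (γ.star_mem_part ha), star_mul, star_mul,
          smul_smul, smul_smul]
        congr 1
        revert i j k l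
        have : ∀ i j k l : ZMod 2, (-1 : ℤˣ) ^ (j * k) * (-1 : ℤˣ) ^ ((i + k) * (j + l)) =
            (-1 : ℤˣ) ^ (k * l) * (-1 : ℤˣ) ^ (i * j) * (-1 : ℤˣ) ^ (l * i) := by decide
        intro i j _ _ k l _ _
        exact this i j k l

end FermiTensor

/-! ### States, normality, channels -/

/-- A state on a unital `*`-algebra. -/
structure IsState {C : Type*} [Ring C] [Module ℂ C] [Star C] (ω : C →ₗ[ℂ] ℂ) : Prop where
  map_one : ω 1 = 1
  nonneg : ∀ c, 0 ≤ ω (star c * c)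

section Operators

variable {H : Type*} [NormedAddCommGroup H] [InnerProductSpace ℂ H] [CompleteSpace H]
variable {G : Type*} [NormedAddCommGroup G] [InnerProductSpace ℂ G] [CompleteSpace G]

/-- The `σ`-weak (ultraweak) topology of a `*`-algebra of bounded operators: the initial topology
for the functionals `a ↦ ∑ ⟨xₙ, a yₙ⟩` with `∑ ‖xₙ‖² < ∞` and `∑ ‖yₙ‖² < ∞`. -/
noncomputable abbrev sigmaWeak (M : StarSubalgebra ℂ (H →L[ℂ] H)) : TopologicalSpace M :=
  ⨅ p : {p : (ℕ → H) × (ℕ → H) //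
      Summable (fun n => ‖p.1 n‖ ^ 2) ∧ Summable (fun n => ‖p.2 n‖ ^ 2)},
    TopologicalSpace.induced
      (fun a : M => ∑' n, ⟪p.1.1 n, (a : H →L[ℂ] H) (p.1.2 n)⟫_ℂ) inferInstance

/-- An even faithful normal state on a graded von Neumann algebra
(normal means `σ`-weakly continuous). -/
structure EvenState {A : VonNeumannAlgebra H} (γ : Grading A.toStarSubalgebra) where
  /-- the underlying linear functional -/
  toLin : A.toStarSubalgebra →ₗ[ℂ] ℂ
  isState : IsState toLin
  faithful : ∀ a, toLin (star a * a) = 0 → a = 0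
  normal : Continuous[sigmaWeak A.toStarSubalgebra, inferInstance] toLin
  even : ∀ a, toLin (γ.aut a) = toLin a

/-- A linear map between `*`-algebras of operators is completely positive if for each `n` its
`n`-th amplification maps the positive elements `N* N` of `Mₙ(M)` to positive operators
on `Gⁿ`. -/
def IsCompletelyPositive {M : StarSubalgebra ℂ (H →L[ℂ] H)} {N : StarSubalgebra ℂ (G →L[ℂ] G)}
    (E : M →ₗ[ℂ] N) : Prop :=
  ∀ (n : ℕ) (T : Matrix (Fin n) (Fin n) M) (x : Fin n → G),
    0 ≤ ∑ i, ∑ j, ⟪x i, (E ((T.conjTranspose * T) i j) : G →L[ℂ] G) (x j)⟫_ℂ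

/-- A channel: a unital completely positive linear map. -/
structure IsChannel {M : StarSubalgebra ℂ (H →L[ℂ] H)} {N : StarSubalgebra ℂ (G →L[ℂ] G)}
    (E : M →ₗ[ℂ] N) : Prop where
  map_one : E 1 = 1
  completelyPositive : IsCompletelyPositive E

/-! ### Standard form -/

/-- `ξ` is cyclic for `B`. -/
def IsCyclicVec (B : VonNeumannAlgebra G) (ξ : G) : Prop :=
  DenseRange (fun b : B.toStarSubalgebra => (b : G →L[ℂ] G) ξ)

/-- `ξ` is separating for `B`. -/
def IsSeparatingVec (B : VonNeumannAlgebra G) (ξ : G) : Prop :=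
  ∀ b : B.toStarSubalgebra, (b : G →L[ℂ] G) ξ = 0 → b = 0

/-- A von Neumann algebra in standard form: a modular conjugation `J`, a closed convex cone (the
natural positive cone), and the representation of the normal states by vectors of the cone. -/
structure StandardForm (B : VonNeumannAlgebra G) where
  /-- the modular conjugation -/
  J : G →ₗ⋆[ℂ] G
  J_sq : ∀ x, J (J x) = x
  J_selfAdjoint : ∀ x y, ⟪J x, y⟫_ℂ = ⟪J y, x⟫_ℂ
  J_conj : ∀ t : G →L[ℂ] G, t ∈ B.commutant ↔ ∃ b ∈ B, ∀ x, t x = J (b (J x))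
  /-- the natural positive cone -/
  cone : ConvexCone ℝ G
  isClosed_cone : IsClosed (cone : Set G)
  J_cone : ∀ x ∈ cone, J x = x
  cyclic_iff_separating : ∀ x ∈ cone, IsCyclicVec B x ↔ IsSeparatingVec B x
  existsUnique_vec : ∀ φ : B.toStarSubalgebra →ₗ[ℂ] ℂ, IsState φ →
    Continuous[sigmaWeak B.toStarSubalgebra, inferInstance] φ →
      ∃! ξ : G, ξ ∈ cone ∧ ∀ b, φ b = ⟪ξ, (b : G →L[ℂ] G) ξ⟫_ℂ

variable {A : VonNeumannAlgebra H} {γA : Grading A.toStarSubalgebra}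
variable {B : VonNeumannAlgebra G} {γB : Grading B.toStarSubalgebra}

/-- The vector `Λ_ν` of the natural positive cone that represents the state `ν`. -/
noncomputable def vec (S : StandardForm B) (ν : EvenState γB) : G :=
  (S.existsUnique_vec ν.toLin ν.isState ν.normal).choose

variable (S : StandardForm B) (ν : EvenState γB)

lemma vec_mem : vec S ν ∈ S.cone :=
  (S.existsUnique_vec ν.toLin ν.isState ν.normal).choose_spec.1.1

lemma vec_spec (b : B.toStarSubalgebra) : ν.toLin b = ⟪vec S ν, (b : G →L[ℂ] G) (vec S ν)⟫_ℂ :=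
  (S.existsUnique_vec ν.toLin ν.isState ν.normal).choose_spec.1.2 b

/-- The map `b ↦ b Λ_ν`. -/
noncomputable def orbit : B.toStarSubalgebra →ₗ[ℂ] G where
  toFun b := (b : G →L[ℂ] G) (vec S ν)
  map_add' _ _ := rfl
  map_smul' _ _ := rfl

lemma inner_orbit (b c : B.toStarSubalgebra) :
    ⟪orbit S ν b, orbit S ν c⟫_ℂ = ν.toLin (star b * c) := by
  rw [vec_spec S ν]
  change ⟪(b : G →L[ℂ] G) (vec S ν), _⟫_ℂ =
    ⟪_, (ContinuousLinearMap.adjoint (b : G →L[ℂ] G)) ((c : G →L[ℂ] G) (vec S ν))⟫_ℂ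
  rw [ContinuousLinearMap.adjoint_inner_right]
  rfl

lemma dense_orbit : DenseRange (orbit S ν) := by
  refine (S.cyclic_iff_separating _ (vec_mem S ν)).2 fun b hb => ν.faithful b ?_
  rw [← inner_orbit S ν]
  change ⟪(b : G →L[ℂ] G) (vec S ν), _⟫_ℂ = 0
  rw [hb, inner_zero_left]

lemma inner_orbit_aut (b c : B.toStarSubalgebra) :
    ⟪orbit S ν (γB.aut b), orbit S ν (γB.aut c)⟫_ℂ = ⟪orbit S ν b, orbit S ν c⟫_ℂ := by
  rw [inner_orbit, inner_orbit, ← map_star, ← map_mul, ν.even]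

lemma norm_orbit_aut (b : B.toStarSubalgebra) :
    ‖(orbit S ν ∘ₗ γB.lin) b‖ ≤ 1 * ‖orbit S ν b‖ := by
  rw [one_mul]
  refine le_of_eq ?_
  rw [← sq_eq_sq₀ (norm_nonneg _) (norm_nonneg _)]
  have h := inner_orbit_aut S ν b b
  rw [inner_self_eq_norm_sq_to_K, inner_self_eq_norm_sq_to_K] at h
  exact_mod_cast h

/-- The unitary representation `g` of the grading on `G`, determined by
`g b Λ_ν = γ(b) Λ_ν` for all `b ∈ B`. A unitary that satisfies this identity for every even
faithful normal state is therefore equal to this one, whichever `ν` is used. -/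
noncomputable def gradingUnitary : G →L[ℂ] G :=
  (orbit S ν ∘ₗ γB.lin).extendOfNorm (orbit S ν)

lemma gradingUnitary_orbit (b : B.toStarSubalgebra) :
    gradingUnitary S ν (orbit S ν b) = orbit S ν (γB.aut b) :=
  LinearMap.extendOfNorm_eq (dense_orbit S ν) ⟨1, norm_orbit_aut S ν⟩ b

lemma gradingUnitary_unique (g : G →L[ℂ] G)
    (hg : ∀ b, g (orbit S ν b) = orbit S ν (γB.aut b)) : g = gradingUnitary S ν := by
  refine ContinuousLinearMap.ext fun x => congrFun ((dense_orbit S ν).equalizer g.continuous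
    (gradingUnitary S ν).continuous (funext fun b => ?_)) x
  simp only [Function.comp_apply, hg, gradingUnitary_orbit]

lemma gradingUnitary_mul_self : gradingUnitary S ν * gradingUnitary S ν = 1 := by
  refine ContinuousLinearMap.ext fun x => congrFun ((dense_orbit S ν).equalizer
    (gradingUnitary S ν * gradingUnitary S ν).continuous
    (1 : G →L[ℂ] G).continuous (funext fun b => ?_)) x
  simp [gradingUnitary_orbit, γB.involutive]

lemma star_gradingUnitary : star (gradingUnitary S ν) = gradingUnitary S ν := by
  refine ContinuousLinearMap.ext fun x => congrFun ((dense_orbit S ν).equalizer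
    (star (gradingUnitary S ν)).continuous
    (gradingUnitary S ν).continuous (funext fun b => ?_)) x
  have hcl : ∀ y, ⟪star (gradingUnitary S ν) (orbit S ν b), y⟫_ℂ =
      ⟪gradingUnitary S ν (orbit S ν b), y⟫_ℂ := by
    intro y
    refine congrFun ((dense_orbit S ν).equalizer (by fun_prop) (by fun_prop)
      (funext fun c => ?_)) y
    have h := inner_orbit_aut S ν b (γB.aut c)
    rw [γB.involutive] at h
    simp only [Function.comp_apply]
    rw [ContinuousLinearMap.star_eq_adjoint, ContinuousLinearMap.adjoint_inner_left,
      gradingUnitary_orbit, gradingUnitary_orbit, h]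
  exact ext_inner_right ℂ hcl

lemma gradingUnitary_conj (b : B.toStarSubalgebra) :
    gradingUnitary S ν * (b : G →L[ℂ] G) * gradingUnitary S ν = (γB.aut b : G →L[ℂ] G) := by
  refine ContinuousLinearMap.ext fun x => congrFun ((dense_orbit S ν).equalizer
    (gradingUnitary S ν * (b : G →L[ℂ] G) * gradingUnitary S ν).continuous
    (γB.aut b : G →L[ℂ] G).continuous (funext fun c => ?_)) x
  have h : ∀ d e : B.toStarSubalgebra, (d : G →L[ℂ] G) (orbit S ν e) = orbit S ν (d * e) :=
    fun _ _ => rfl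
  change gradingUnitary S ν ((b : G →L[ℂ] G) (gradingUnitary S ν (orbit S ν c))) =
    (γB.aut b : G →L[ℂ] G) (orbit S ν c)
  rw [gradingUnitary_orbit, h, gradingUnitary_orbit, map_mul, γB.involutive, h]

/-- The unitary `g^{1/2} = p⁺ - i p⁻`, where `p^± = (1 ± g) / 2`. -/
noncomputable def gradingHalf : unitary (G →L[ℂ] G) :=
  ⟨(2⁻¹ : ℂ) • (1 + gradingUnitary S ν) - (Complex.I * 2⁻¹) • (1 - gradingUnitary S ν), by
    have h1 := gradingUnitary_mul_self S ν
    have h2 := star_gradingUnitary S ν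
    set g := gradingUnitary S ν
    have key : ∀ a b c d : ℂ, (a • (1 + g) + b • (1 - g)) * (c • (1 + g) + d • (1 - g)) =
        (2 * a * c) • (1 + g) + (2 * b * d) • (1 - g) := by
      intro a b c d
      have e1 : (1 + g) * (1 + g) = (2 : ℂ) • (1 + g) := by
        rw [two_smul, mul_add, add_mul, add_mul, h1]; simp only [one_mul, mul_one]; abel
      have e2 : (1 + g) * (1 - g) = 0 := by
        rw [mul_sub, add_mul, add_mul, h1]; simp [add_comm]
      have e3 : (1 - g) * (1 + g) = 0 := by
        rw [mul_add, sub_mul, sub_mul, h1]; simp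
      have e4 : (1 - g) * (1 - g) = (2 : ℂ) • (1 - g) := by
        rw [two_smul, mul_sub, sub_mul, sub_mul, h1]; simp only [one_mul, mul_one]; abel
      rw [add_mul, mul_add, mul_add, smul_mul_smul_comm, smul_mul_smul_comm, smul_mul_smul_comm,
        smul_mul_smul_comm, e1, e2, e3, e4, smul_smul, smul_smul, smul_zero, smul_zero, add_zero,
        zero_add]
      congr 2 <;> ring
    have hs : star ((2⁻¹ : ℂ) • (1 + g) - (Complex.I * 2⁻¹) • (1 - g)) =
        (2⁻¹ : ℂ) • (1 + g) + (Complex.I * 2⁻¹) • (1 - g) := by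
      simp [h2]
    have hr : (2⁻¹ : ℂ) • (1 + g) - (Complex.I * 2⁻¹) • (1 - g) =
        (2⁻¹ : ℂ) • (1 + g) + (-(Complex.I * 2⁻¹)) • (1 - g) := by
      rw [neg_smul, sub_eq_add_neg]
    have hI : (2 : ℂ) * (Complex.I * 2⁻¹) * (-(Complex.I * 2⁻¹)) = 2⁻¹ := by
      linear_combination (-(2 : ℂ)⁻¹) * Complex.I_mul_I
    have hI' : (2 : ℂ) * (-(Complex.I * 2⁻¹)) * (Complex.I * 2⁻¹) = 2⁻¹ := by
      linear_combination (-(2 : ℂ)⁻¹) * Complex.I_mul_I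
    have h4 : (2 : ℂ) * 2⁻¹ * 2⁻¹ = 2⁻¹ := by norm_num
    have hone : (2⁻¹ : ℂ) • (1 + g) + (2⁻¹ : ℂ) • (1 - g) = 1 := by
      rw [← smul_add, show (1 + g) + (1 - g) = (2 : ℂ) • (1 : G →L[ℂ] G) by
        rw [two_smul]; abel, smul_smul]
      norm_num
    rw [Unitary.mem_iff, hs, hr, key, key, hI, hI', h4]
    exact ⟨hone, hone⟩⟩

lemma gradingHalf_commute :
    Commute (gradingUnitary S ν) (gradingHalf S ν : G →L[ℂ] G) := by
  refine Commute.sub_right (Commute.smul_right ?_ _) (Commute.smul_right ?_ _)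
  · exact (Commute.one_right _).add_right (Commute.refl _)
  · exact (Commute.one_right _).sub_right (Commute.refl _)

/-- The twisted commutant `B^≀ = g^{1/2} B' g^{-1/2}`. -/
noncomputable def twistedCommutant : StarSubalgebra ℂ (G →L[ℂ] G) :=
  B.commutant.toStarSubalgebra.map
    (Unitary.conjStarAlgAut ℂ (G →L[ℂ] G) (gradingHalf S ν)).toStarAlgHom

/-- The Klein isomorphism `γ^{1/2} : B' → B^≀`, `b' ↦ g^{1/2} b' g^{-1/2}`, as a linear map. -/
noncomputable def klein : B.commutant.toStarSubalgebra →ₗ[ℂ] twistedCommutant S ν where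
  toFun b := ⟨gradingHalf S ν * (b : G →L[ℂ] G) * star (gradingHalf S ν : G →L[ℂ] G),
    ⟨b, b.2, rfl⟩⟩
  map_add' x y := Subtype.ext (by simp [mul_add, add_mul])
  map_smul' c x := Subtype.ext (by simp)

/-- The grading `x ↦ g x g` of a `*`-algebra of operators that is invariant under it. -/
noncomputable def conjGrading (M : StarSubalgebra ℂ (G →L[ℂ] G))
    (hM : ∀ x ∈ M, gradingUnitary S ν * x * gradingUnitary S ν ∈ M) : Grading M where
  aut :=
    { toFun := fun x => ⟨gradingUnitary S ν * (x : G →L[ℂ] G) * gradingUnitary S ν, hM x x.2⟩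
      invFun := fun x => ⟨gradingUnitary S ν * (x : G →L[ℂ] G) * gradingUnitary S ν, hM x x.2⟩
      left_inv := fun x => Subtype.ext (by
        have h := gradingUnitary_mul_self S ν
        simp only [mul_assoc, h, mul_one]
        rw [← mul_assoc, h, one_mul])
      right_inv := fun x => Subtype.ext (by
        have h := gradingUnitary_mul_self S ν
        simp only [mul_assoc, h, mul_one]
        rw [← mul_assoc, h, one_mul])
      map_mul' := fun x y => Subtype.ext (by
        have h := gradingUnitary_mul_self S ν
        change _ * ((x : G →L[ℂ] G) * (y : G →L[ℂ] G)) * _ =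
          gradingUnitary S ν * (x : G →L[ℂ] G) * gradingUnitary S ν *
            (gradingUnitary S ν * (y : G →L[ℂ] G) * gradingUnitary S ν)
        simp only [mul_assoc]
        rw [← mul_assoc (gradingUnitary S ν) (gradingUnitary S ν), h, one_mul])
      map_add' := fun x y => Subtype.ext (by simp [mul_add, add_mul])
      map_smul' := fun c x => Subtype.ext (by simp)
      map_star' := fun x => Subtype.ext (by
        simp [star_gradingUnitary S ν, mul_assoc]) }
  involutive := fun x => Subtype.ext (by
    have h := gradingUnitary_mul_self S ν
    change gradingUnitary S ν * (gradingUnitary S ν * (x : G →L[ℂ] G) * gradingUnitary S ν) *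
      gradingUnitary S ν = x
    simp only [mul_assoc, h, mul_one]
    rw [← mul_assoc, h, one_mul])

lemma conj_mem_commutant (x : G →L[ℂ] G) (hx : x ∈ B.commutant.toStarSubalgebra) :
    gradingUnitary S ν * x * gradingUnitary S ν ∈ B.commutant.toStarSubalgebra := by
  have hx' := VonNeumannAlgebra.mem_commutant_iff.1 hx
  refine VonNeumannAlgebra.mem_commutant_iff.2 fun b hb => ?_
  have h := gradingUnitary_mul_self S ν
  have h1 := gradingUnitary_conj S ν ⟨b, hb⟩
  have h2 := hx' _ (γB.aut ⟨b, hb⟩).2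
  rw [← h1] at h2
  set g := gradingUnitary S ν
  simp only at h2
  calc b * (g * x * g) = (g * g) * b * (g * x * g) := by rw [h, one_mul]
    _ = g * (g * b * g * x) * g := by simp only [mul_assoc]
    _ = g * (x * (g * b * g)) * g := by rw [h2]
    _ = g * x * g * b * (g * g) := by simp only [mul_assoc]
    _ = g * x * g * b := by rw [h, mul_one]

lemma conj_mem_twistedCommutant (x : G →L[ℂ] G) (hx : x ∈ twistedCommutant S ν) :
    gradingUnitary S ν * x * gradingUnitary S ν ∈ twistedCommutant S ν := by
  obtain ⟨y, hy, rfl⟩ := hx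
  refine ⟨gradingUnitary S ν * y * gradingUnitary S ν, conj_mem_commutant S ν y hy, ?_⟩
  have h1 := (gradingHalf_commute S ν).eq
  have h2 : star (gradingHalf S ν : G →L[ℂ] G) * gradingUnitary S ν =
      gradingUnitary S ν * star (gradingHalf S ν : G →L[ℂ] G) := by
    have := congrArg star h1
    simpa [star_gradingUnitary S ν] using this
  change (gradingHalf S ν : G →L[ℂ] G) * (gradingUnitary S ν * y * gradingUnitary S ν) *
      star (gradingHalf S ν : G →L[ℂ] G) = gradingUnitary S ν *
      ((gradingHalf S ν : G →L[ℂ] G) * y * star (gradingHalf S ν : G →L[ℂ] G)) *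
        gradingUnitary S ν
  simp only [mul_assoc]
  rw [h2, ← mul_assoc (gradingHalf S ν : G →L[ℂ] G), ← h1]
  simp only [mul_assoc]

/-- The grading `b' ↦ g b' g` of the commutant. -/
noncomputable def commutantGrading : Grading B.commutant.toStarSubalgebra :=
  conjGrading S ν _ (conj_mem_commutant S ν)

/-- The grading `b^≀ ↦ g b^≀ g` of the twisted commutant. -/
noncomputable def twistedGrading : Grading (twistedCommutant S ν) :=
  conjGrading S ν _ (conj_mem_twistedCommutant S ν)

/-! ### Transport plans -/

/-- The linear functional `x ↦ ⟨Λ_ν, x Λ_ν⟩`; its restrictions to `B'` and `B^≀` are the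
states `ν'` and `ν^≀`. -/
noncomputable def vecFunctional : (G →L[ℂ] G) →ₗ[ℂ] ℂ where
  toFun x := ⟪vec S ν, x (vec S ν)⟫_ℂ
  map_add' x y := by simp
  map_smul' c x := by simp

/-- The set `T^F(μ, ν)` of fermionic transport plans from `μ` to `ν`. -/
def fermionicPlans (μ : EvenState γA) (S : StandardForm B) (ν : EvenState γB) :
    Set (Fermi γA (twistedGrading S ν) →ₗ[ℂ] ℂ) :=
  {ω | IsState ω ∧
    (∀ a, ω (ftmul γA (twistedGrading S ν) a 1) = μ.toLin a) ∧
    (∀ b : twistedCommutant S ν,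
      ω (ftmul γA (twistedGrading S ν) 1 b) = vecFunctional S ν (b : G →L[ℂ] G)) ∧
    ∀ a b, ω (ftmul γA (twistedGrading S ν) (γA.aut a) b) =
      ω (ftmul γA (twistedGrading S ν) a ((twistedGrading S ν).aut b))}

/-- The set `T^γ(μ, ν)` of graded transport plans from `μ` to `ν` on the usual algebraic tensor
product `A ⊙ B'`. -/
def gradedPlans (μ : EvenState γA) (S : StandardForm B) (ν : EvenState γB) :
    Set (A.toStarSubalgebra ⊗[ℂ] B.commutant.toStarSubalgebra →ₗ[ℂ] ℂ) :=
  {ω | IsState ω ∧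
    (∀ a, ω (a ⊗ₜ[ℂ] 1) = μ.toLin a) ∧
    (∀ b : B.commutant.toStarSubalgebra,
      ω (1 ⊗ₜ[ℂ] b) = vecFunctional S ν (b : G →L[ℂ] G)) ∧
    ∀ a b, ω (γA.aut a ⊗ₜ[ℂ] b) = ω (a ⊗ₜ[ℂ] (commutantGrading S ν).aut b)}

/-- For `*`-algebras of operators `M`, `N` on `G`, the linear map `M ⊙ N → B(G)` with
`x ⊙ y ↦ x y`. -/
noncomputable def mulTensor (M N : StarSubalgebra ℂ (G →L[ℂ] G)) : M ⊗[ℂ] N →ₗ[ℂ] (G →L[ℂ] G) :=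
  LinearMap.mul' ℂ (G →L[ℂ] G) ∘ₗ
    TensorProduct.map M.toSubalgebra.val.toLinearMap N.toSubalgebra.val.toLinearMap

/-- The usual diagonal transport plan `δ_ν(b ⊙ b') = ⟨Λ_ν, b b' Λ_ν⟩`. -/
noncomputable def diagonalPlan :
    B.toStarSubalgebra ⊗[ℂ] B.commutant.toStarSubalgebra →ₗ[ℂ] ℂ :=
  vecFunctional S ν ∘ₗ mulTensor B.toStarSubalgebra B.commutant.toStarSubalgebra

/-- The fermionic diagonal transport plan `δ^F_ν(b ⊠ b^≀) = ⟨Λ_ν, b b^≀ Λ_ν⟩`. -/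
noncomputable def fermionicDiagonalPlan : Fermi γB (twistedGrading S ν) →ₗ[ℂ] ℂ :=
  vecFunctional S ν ∘ₗ mulTensor B.toStarSubalgebra (twistedCommutant S ν) ∘ₗ
    (GradedTensorProduct.of ℂ γB.part (twistedGrading S ν).part).symm.toLinearMap

/-! ### The usual transport plan associated with a fermionic one

The cyclic representation of `ω` is left multiplication `π⁰(c)[d] = [c d]` on classes modulo
`{c | ω(c* c) = 0}`, with `⟨[c], [d]⟩ = ω(c* d)`, cyclic vector `Ω = [1]` and grading operator
`h[c] = [(γ_A ⊠ γ_{B^≀}) c]`. The operators below are these ones, written on representatives. -/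

section Usual

variable (γA)

/-- `h`, on representatives: the linear map `γ_A ⊠ γ_{B^≀}`. -/
noncomputable def hOp : Module.End ℂ (Fermi γA (twistedGrading S ν)) :=
  fermiMap γA (twistedGrading S ν) γA (twistedGrading S ν) γA.lin (twistedGrading S ν).lin

/-- `h^{1/2} = q⁺ - i q⁻`, where `q^± = (1 ± h) / 2`. -/
noncomputable def hHalf : Module.End ℂ (Fermi γA (twistedGrading S ν)) :=
  (2⁻¹ : ℂ) • (1 + hOp γA S ν) - (Complex.I * 2⁻¹) • (1 - hOp γA S ν)

/-- `h^{-1/2} = q⁺ + i q⁻`. -/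
noncomputable def hHalfInv : Module.End ℂ (Fermi γA (twistedGrading S ν)) :=
  (2⁻¹ : ℂ) • (1 + hOp γA S ν) + (Complex.I * 2⁻¹) • (1 - hOp γA S ν)

/-- The representation `π⁰` by left multiplication. -/
noncomputable def leftRep :
    Fermi γA (twistedGrading S ν) →ₗ[ℂ] Module.End ℂ (Fermi γA (twistedGrading S ν)) :=
  LinearMap.mul ℂ (Fermi γA (twistedGrading S ν))

/-- `η^{-1/2}(t) = h^{-1/2} t h^{1/2}`. -/
noncomputable def etaHalfInv : Module.End ℂ (Fermi γA (twistedGrading S ν)) →ₗ[ℂ]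
    Module.End ℂ (Fermi γA (twistedGrading S ν)) where
  toFun t := hHalfInv γA S ν * t * hHalf γA S ν
  map_add' x y := by rw [mul_add, add_mul]
  map_smul' c x := by simp

/-- `π^us(a ⊙ b') = π⁰(a ⊠ 1) η^{-1/2}(π⁰(1 ⊠ γ_B^{1/2}(b')))`, as a bilinear map in `(a, b')`. -/
noncomputable def usualRep : A.toStarSubalgebra →ₗ[ℂ] B.commutant.toStarSubalgebra →ₗ[ℂ]
    Module.End ℂ (Fermi γA (twistedGrading S ν)) :=
  (LinearMap.mul ℂ (Module.End ℂ (Fermi γA (twistedGrading S ν)))).compl₁₂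
    (leftRep γA S ν ∘ₗ
      (GradedTensorProduct.includeLeft γA.part (twistedGrading S ν).part).toLinearMap)
    (etaHalfInv γA S ν ∘ₗ leftRep γA S ν ∘ₗ
      (GradedTensorProduct.includeRight γA.part (twistedGrading S ν).part).toLinearMap ∘ₗ
      klein S ν)

variable {γA}

/-- The functional `ω_⊙(c) = ⟨Ω, π^us(c) Ω⟩` on `A ⊙ B'`. -/
noncomputable def usualPlan (ω : Fermi γA (twistedGrading S ν) →ₗ[ℂ] ℂ) :
    A.toStarSubalgebra ⊗[ℂ] B.commutant.toStarSubalgebra →ₗ[ℂ] ℂ :=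
  ω ∘ₗ LinearMap.applyₗ (1 : Fermi γA (twistedGrading S ν)) ∘ₗ
    TensorProduct.lift (usualRep γA S ν)

end Usual

end Operators

end FermiOT

/-! The twists in the definition of `ω_⊙` cancel on the cyclic vector. On `B'` the Klein isomorphism
sends an odd `b'` to `-i b' g`, conjugation by `h^{-1/2}` restores the factor `i`, and therefore
`ω_⊙ (a ⊙ b') = ω (a ⊠ ψ b')` for the linear bijection `ψ : B' → B^≀` that is the identity on even
elements and `b' ↦ b' g` on odd ones (`usualPlan_tmul`). Since `g Λ_ν = Λ_ν`, also
`ψ b' Λ_ν = b' Λ_ν`. The signs in the Fermi product compensate the failure of `ψ` to be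
multiplicative wherever `ω` does not vanish, so `ω_⊙ (c* d) = ω ((Ψ c)* (Ψ d))` with `Ψ = id ⊙ ψ`
(`usualPlan_star_mul`). Hence `ω_⊙` is a state, it lies in `T^γ(μ, ν)`, and `ω = δ^F_ν ∘ (E ⊠ id)` is
equivalent to `ω_⊙ = δ_ν ∘ (E ⊙ id)`.

For a plan `φ` on `A ⊙ B'`, the Cauchy–Schwarz inequality bounds the form
`(x Λ_ν, y Λ_ν) ↦ φ (a ⊙ x* y)` by `‖a‖ ‖x Λ_ν‖ ‖y Λ_ν‖`. The vectors `x Λ_ν`, `x ∈ B'`, are dense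
because `B' = J B J` and `J Λ_ν = Λ_ν`, so the form is given by a bounded operator `E a`, which
commutes with `B'` and so lies in `B` (`exists_linearMap_of_gradedPlan`). The algebraic properties
of `E` are read off from the matrix entries `⟨x Λ_ν, E a y Λ_ν⟩ = φ (a ⊙ x* y)`.

Normality is proved in the amplified representation of `A` on `ℓ²(ℕ, H)`. The normal state `μ` is
dominated by a vector functional there (`exists_norm_map_star_mul_self_le`), and for `y ∈ B'` the
positive functional `φ (· ⊙ y* y)` is dominated by a multiple of `μ`, hence is itself a vector
functional (`exists_vector_of_dominated`). This yields `‖E a y Λ_ν‖ ≤ ‖a ξ‖` with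
`‖ξ‖ = ‖y Λ_ν‖`; the equality of norms makes it possible to pass to arbitrary vectors of the Hilbert
space of `B` by rapidly convergent series (`exists_norm_channel_le`), and then to square-summable
sequences of them (`channel_normal`). -/

namespace FermiOT

/-! ### Positive functionals and bounded forms -/

section Forms

variable {C : Type*} [Ring C] [StarRing C] [Algebra ℂ C] [StarModule ℂ C]

/-- Positive functionals are hermitian, by polarization. -/
lemma map_star_mul_symm {φ : C →ₗ[ℂ] ℂ} (hφ : ∀ c, 0 ≤ φ (star c * c)) (c d : C) :
    star (φ (star d * c)) = φ (star c * d) := by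
  have him : ∀ c, (φ (star c * c)).im = 0 := fun c => (Complex.nonneg_iff.1 (hφ c)).2.symm
  have h1 := him (c + d)
  have h2 := him (c + Complex.I • d)
  have e1 : φ (star (c + d) * (c + d)) = φ (star c * c) + φ (star c * d) + φ (star d * c) +
      φ (star d * d) := by
    simp only [star_add, add_mul, mul_add, map_add]; ring
  have e2 : φ (star (c + Complex.I • d) * (c + Complex.I • d)) =
      φ (star c * c) + Complex.I * φ (star c * d) - Complex.I * φ (star d * c) +
      φ (star d * d) := by
    simp only [star_add, star_smul, add_mul, mul_add, map_add, smul_mul_assoc, mul_smul_comm,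
      map_smul, smul_eq_mul, RCLike.star_def, Complex.conj_I]
    linear_combination (-φ (star d * d)) * Complex.I_mul_I
  rw [e1] at h1
  rw [e2] at h2
  have h3 := him c
  have h4 := him d
  simp at h1 h2
  apply Complex.ext
  · simp; linarith
  · simp; linarith

/-- The Cauchy–Schwarz inequality for a positive functional on a `*`-algebra. -/
theorem norm_map_star_mul_sq_le {φ : C →ₗ[ℂ] ℂ} (hφ : ∀ c, 0 ≤ φ (star c * c)) (c d : C) :
    ‖φ (star c * d)‖ ^ 2 ≤ (φ (star c * c)).re * (φ (star d * d)).re := by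
  let core : PreInnerProductSpace.Core ℂ C :=
    { inner := fun c d => φ (star c * d)
      conj_inner_symm := fun c d => map_star_mul_symm hφ c d
      re_inner_nonneg := fun c => (Complex.nonneg_iff.1 (hφ c)).1
      add_left := fun a b c => by simp only [star_add, add_mul, map_add]
      smul_left := fun a b c => by simp }
  have h := @InnerProductSpace.Core.inner_mul_inner_self_le ℂ C _ _ _ core c d
  have hs : ‖φ (star d * c)‖ = ‖φ (star c * d)‖ := by
    rw [← map_star_mul_symm hφ c d, norm_star]
  change ‖φ (star c * d)‖ * ‖φ (star d * c)‖ ≤ _ at h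
  rw [hs, ← sq] at h
  exact h

variable {V : Type*} [AddCommGroup V] [Module ℂ V]
variable {K : Type*} [NormedAddCommGroup K] [InnerProductSpace ℂ K]

/-- The corestriction of a linear map to the closure of its range. -/
noncomputable def toClosure (e : V →ₗ[ℂ] K) : V →ₗ[ℂ] (LinearMap.range e).topologicalClosure :=
  e.codRestrict _ fun v => (LinearMap.range e).le_topologicalClosure (LinearMap.mem_range_self e v)

lemma denseRange_toClosure (e : V →ₗ[ℂ] K) : DenseRange (toClosure e) := by
  intro x
  rw [closure_subtype]
  have h : ((↑) : (LinearMap.range e).topologicalClosure → K) '' Set.range (toClosure e) =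
      (LinearMap.range e : Set K) := by
    rw [← Set.range_comp, LinearMap.coe_range]
    rfl
  rw [h]
  exact x.2

variable [CompleteSpace K]

/-- A linear functional dominated by the norm of a dense linear map is represented by a vector. -/
lemma exists_inner_eq_of_denseRange {e : V →ₗ[ℂ] K} (he : DenseRange e) (f : V →ₗ[ℂ] ℂ)
    {c : ℝ} (hc : 0 ≤ c) (hf : ∀ v, ‖f v‖ ≤ c * ‖e v‖) :
    ∃ η : K, ‖η‖ ≤ c ∧ ∀ v, f v = ⟪η, e v⟫_ℂ := by
  refine ⟨(InnerProductSpace.toDual ℂ K).symm (f.extendOfNorm e), ?_, fun v => ?_⟩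
  · rw [LinearIsometryEquiv.norm_map]
    exact LinearMap.opNorm_extendOfNorm_le he hc hf
  · rw [InnerProductSpace.toDual_symm_apply, LinearMap.extendOfNorm_eq he ⟨c, hf⟩]

lemma exists_inner_eq (e : V →ₗ[ℂ] K) (f : V →ₗ[ℂ] ℂ) {c : ℝ} (hc : 0 ≤ c)
    (hf : ∀ v, ‖f v‖ ≤ c * ‖e v‖) : ∃ η : K, ∀ v, f v = ⟪η, e v⟫_ℂ := by
  obtain ⟨η, -, hη⟩ := exists_inner_eq_of_denseRange (denseRange_toClosure e) f hc hf
  exact ⟨η, hη⟩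

/-- A sesquilinear form that is bounded with respect to a dense linear map is represented by a
bounded operator. -/
theorem exists_operator_of_form {e : V →ₗ[ℂ] K} (he : DenseRange e) (s : V →ₗ⋆[ℂ] V →ₗ[ℂ] ℂ)
    {c : ℝ} (hc : 0 ≤ c) (hs : ∀ v w, ‖s v w‖ ≤ c * ‖e v‖ * ‖e w‖) :
    ∃ T : K →L[ℂ] K, ∀ v w, ⟪e v, T (e w)⟫_ℂ = s v w := by
  have hr : ∀ v, ∃ η : K, ‖η‖ ≤ c * ‖e v‖ ∧ ∀ w, s v w = ⟪η, e w⟫_ℂ := fun v =>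
    exists_inner_eq_of_denseRange he (s v) (by positivity) (hs v)
  choose r hr1 hr2 using hr
  let R : V →ₗ[ℂ] K :=
    { toFun := r
      map_add' := fun v w => he.eq_of_inner_left ℂ fun u => by
        rw [inner_add_left, ← hr2, ← hr2, ← hr2, map_add, LinearMap.add_apply]
      map_smul' := fun a v => he.eq_of_inner_left ℂ fun u => by
        rw [RingHom.id_apply, inner_smul_left, ← hr2, ← hr2, map_smulₛₗ, LinearMap.smul_apply,
          smul_eq_mul] }
  refine ⟨ContinuousLinearMap.adjoint (R.extendOfNorm e), fun v w => ?_⟩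
  rw [ContinuousLinearMap.adjoint_inner_right, LinearMap.extendOfNorm_eq he ⟨c, hr1⟩, hr2]
  rfl

/-- The form `(c, d) ↦ φ (c* d)` of a functional on a `*`-algebra. -/
noncomputable def starForm (φ : C →ₗ[ℂ] ℂ) : C →ₗ⋆[ℂ] C →ₗ[ℂ] ℂ :=
  LinearMap.mk₂'ₛₗ (starRingEnd ℂ) (RingHom.id ℂ) (fun c d => φ (star c * d))
    (fun a b c => by simp only [star_add, add_mul, map_add])
    (fun a b c => by simp)
    (fun a b c => by simp only [mul_add, map_add])
    (fun a b c => by simp)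

lemma starForm_apply (φ : C →ₗ[ℂ] ℂ) (c d : C) : starForm φ c d = φ (star c * d) := rfl

/-- The case of a cyclic vector of `exists_vector_of_dominated`. The form `φ (c* d)` is given by a
positive operator that commutes with the representation, hence so does its square root. -/
lemma exists_vector_of_dominated_of_denseRange {f : C →ₗ[ℂ] K} (hf : DenseRange f)
    (ρ : C → K →L[ℂ] K) (hρ : ∀ c d, ρ c (f d) = f (c * d))
    (hρ' : ∀ c, ContinuousLinearMap.adjoint (ρ c) = ρ (star c)) {φ : C →ₗ[ℂ] ℂ}
    (hφ : ∀ c, 0 ≤ φ (star c * c)) {r : ℝ} (hr : 0 ≤ r)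
    (h : ∀ c, (φ (star c * c)).re ≤ r * ‖f c‖ ^ 2) :
    ∃ ξ : K, ∀ c, φ c = ⟪ξ, ρ c ξ⟫_ℂ := by
  obtain ⟨T, hT⟩ := exists_operator_of_form hf (starForm φ) hr (fun c d => by
    rw [starForm_apply, ← pow_le_pow_iff_left₀ (norm_nonneg _) (by positivity) two_ne_zero]
    calc ‖φ (star c * d)‖ ^ 2 ≤ (φ (star c * c)).re * (φ (star d * d)).re :=
          norm_map_star_mul_sq_le hφ c d
      _ ≤ (r * ‖f c‖ ^ 2) * (r * ‖f d‖ ^ 2) :=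
          mul_le_mul (h c) (h d) (Complex.nonneg_iff.1 (hφ d)).1 (by positivity)
      _ = (r * ‖f c‖ * ‖f d‖) ^ 2 := by ring)
  simp only [starForm_apply] at hT
  have hTpos' : ∀ x, 0 ≤ ⟪x, T x⟫_ℂ := fun x =>
    hf.induction_on (p := fun x => 0 ≤ ⟪x, T x⟫_ℂ) x
      (isClosed_le continuous_const (by fun_prop)) fun c => by rw [hT]; exact hφ c
  have hTpos : 0 ≤ T := by
    rw [ContinuousLinearMap.nonneg_iff_isPositive, ContinuousLinearMap.isPositive_iff_complex]
    intro x
    obtain ⟨h1, h2⟩ := Complex.nonneg_iff.1 (hTpos' x)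
    have h3 : ⟪T x, x⟫_ℂ = ⟪x, T x⟫_ℂ := by
      rw [← inner_conj_symm]
      exact Complex.conj_eq_iff_im.2 h2.symm
    rw [h3]
    exact ⟨Complex.ext rfl h2, h1⟩
  have hcomm : ∀ c, Commute T (ρ c) := fun c => by
    have key : ∀ b d, ⟪f b, T (ρ c (f d))⟫_ℂ = ⟪f b, ρ c (T (f d))⟫_ℂ := fun b d => by
      rw [hρ, hT, ← ContinuousLinearMap.adjoint_inner_left, hρ', hρ, hT, star_mul, star_star,
        mul_assoc]
    refine ContinuousLinearMap.ext fun x => congrFun (hf.equalizer (T * ρ c).continuous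
      (ρ c * T).continuous (funext fun d => ?_)) x
    exact hf.eq_of_inner_right ℂ fun b => key b d
  have hcommR : ∀ c, Commute (CFC.sqrt T) (ρ c) := fun c => (hcomm c).cfcₙ_nnreal _
  have hRsa : IsSelfAdjoint (CFC.sqrt T) := .of_nonneg (CFC.sqrt_nonneg T)
  refine ⟨CFC.sqrt T (f 1), fun c => ?_⟩
  have h1 : ρ c (CFC.sqrt T (f 1)) = CFC.sqrt T (f c) := by
    have := congrArg (fun S : K →L[ℂ] K => S (f 1)) (hcommR c).eq
    simp only [mul_apply_eq_comp] at this
    rw [← this, hρ, mul_one]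
  have h2 : CFC.sqrt T (CFC.sqrt T (f c)) = T (f c) := by
    rw [← mul_apply_eq_comp, CFC.sqrt_mul_sqrt_self T hTpos]
  have h3 := ContinuousLinearMap.adjoint_inner_right (CFC.sqrt T) (f 1) (CFC.sqrt T (f c))
  rw [← ContinuousLinearMap.star_eq_adjoint, hRsa.star_eq, h2, hT, star_one, one_mul] at h3
  rw [h1, h3]

/-- A positive functional that is dominated by a vector functional of a `*`-representation is
itself a vector functional: the square root of the Radon–Nikodym derivative, applied to the given
vector, represents it. -/
theorem exists_vector_of_dominated (π : C →⋆ₐ[ℂ] (K →L[ℂ] K)) (ζ : K) {φ : C →ₗ[ℂ] ℂ}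
    (hφ : ∀ c, 0 ≤ φ (star c * c)) {r : ℝ} (hr : 0 ≤ r)
    (h : ∀ c, (φ (star c * c)).re ≤ r * ‖π c ζ‖ ^ 2) :
    ∃ ξ : K, ∀ c, φ c = ⟪ξ, π c ξ⟫_ℂ := by
  let e : C →ₗ[ℂ] K :=
    { toFun := fun c => π c ζ
      map_add' := fun c d => by simp
      map_smul' := fun a c => by simp }
  have hmul : ∀ c d, π c (e d) = e (c * d) := fun c d => by simp [e]
  let M := (LinearMap.range e).topologicalClosure
  have : CompleteSpace M := (Submodule.isClosed_topologicalClosure _).completeSpace_coe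
  have hf : DenseRange (toClosure e) := denseRange_toClosure e
  -- the compression of `π c` to the invariant subspace `M`
  let ρ : C → M →L[ℂ] M := fun c => M.orthogonalProjectionOnto ∘L π c ∘L M.subtypeL
  have hρf : ∀ c d, ρ c (toClosure e d) = toClosure e (c * d) := fun c d => by
    change M.orthogonalProjectionOnto (π c (e d)) = _
    rw [hmul]
    exact M.orthogonalProjectionOnto_mem_subspace_eq_self (toClosure e (c * d))
  have hρ : ∀ c (x : M), (ρ c x : K) = π c x := fun c x => by
    refine congrFun (hf.equalizer (g := fun x : M => (ρ c x : K)) (h := fun x : M => π c x)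
      (by fun_prop) (by fun_prop) (funext fun d => ?_)) x
    change (ρ c (toClosure e d) : K) = π c (e d)
    rw [hρf, hmul]
    rfl
  have hρ' : ∀ c, ContinuousLinearMap.adjoint (ρ c) = ρ (star c) := fun c => by
    symm
    rw [ContinuousLinearMap.eq_adjoint_iff]
    intro x y
    rw [Submodule.coe_inner, Submodule.coe_inner, hρ, hρ, map_star,
      ContinuousLinearMap.star_eq_adjoint, ContinuousLinearMap.adjoint_inner_left]
  obtain ⟨ξ, hξ⟩ := exists_vector_of_dominated_of_denseRange hf ρ hρf hρ' hφ hr h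
  exact ⟨ξ, fun c => by rw [hξ, Submodule.coe_inner, hρ]⟩

end Forms

section VonNeumann

variable {H : Type*} [NormedAddCommGroup H] [InnerProductSpace ℂ H] [CompleteSpace H]

/-- `‖a‖² - a* a` is of the form `c* c` with `c` in `A`: the square root of a positive element of a von Neumann
algebra commutes with everything that the element commutes with. -/
lemma exists_star_mul_self_add (A : VonNeumannAlgebra H) (a : A.toStarSubalgebra) :
    ∃ c : A.toStarSubalgebra,
      star a * a + star c * c = ((‖(a : H →L[ℂ] H)‖ ^ 2 : ℝ) : ℂ) • 1 := by
  let x : H →L[ℂ] H := algebraMap ℝ _ (‖(a : H →L[ℂ] H)‖ ^ 2) - star (a : H →L[ℂ] H) * a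
  have hx : 0 ≤ x := sub_nonneg.2 CStarAlgebra.star_mul_le_algebraMap_norm_sq
  have hmem : x ∈ A :=
    sub_mem (algebraMap_mem A.toStarSubalgebra (((‖(a : H →L[ℂ] H)‖ ^ 2 : ℝ) : ℂ)))
      (mul_mem (star_mem a.2) a.2)
  have hc : CFC.sqrt x ∈ A := by
    rw [← A.commutant_commutant, VonNeumannAlgebra.mem_commutant_iff]
    intro y hy
    have hxy : Commute x y := (VonNeumannAlgebra.mem_commutant_iff.1 hy x hmem)
    exact (hxy.cfcₙ_nnreal _).eq.symm
  refine ⟨⟨CFC.sqrt x, hc⟩, Subtype.ext ?_⟩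
  change star (a : H →L[ℂ] H) * a + star (CFC.sqrt x) * CFC.sqrt x = _
  rw [(IsSelfAdjoint.of_nonneg (CFC.sqrt_nonneg x)).star_eq, CFC.sqrt_mul_sqrt_self x hx]
  simp only [x, add_sub_cancel]
  rw [Algebra.algebraMap_eq_smul_one]
  rfl

end VonNeumann

/-! ### Removing the Klein twist -/

section Klein

variable {H : Type*} [NormedAddCommGroup H] [InnerProductSpace ℂ H] [CompleteSpace H]
variable {G : Type*} [NormedAddCommGroup G] [InnerProductSpace ℂ G] [CompleteSpace G]
variable {A : VonNeumannAlgebra H} {γA : Grading A.toStarSubalgebra}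
variable {B : VonNeumannAlgebra G} {γB : Grading B.toStarSubalgebra}
variable (S : StandardForm B) (ν : EvenState γB)

lemma gradingUnitary_vec : gradingUnitary S ν (vec S ν) = vec S ν := by
  have h := gradingUnitary_orbit S ν 1
  rw [map_one γB.aut] at h
  exact h

lemma coe_commutantGrading (b : B.commutant.toStarSubalgebra) :
    ((commutantGrading S ν).aut b : G →L[ℂ] G) =
      gradingUnitary S ν * (b : G →L[ℂ] G) * gradingUnitary S ν := rfl

lemma coe_twistedGrading (b : twistedCommutant S ν) :
    ((twistedGrading S ν).aut b : G →L[ℂ] G) =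
      gradingUnitary S ν * (b : G →L[ℂ] G) * gradingUnitary S ν := rfl

lemma coe_klein (b : B.commutant.toStarSubalgebra) :
    (klein S ν b : G →L[ℂ] G) =
      (gradingHalf S ν : G →L[ℂ] G) * (b : G →L[ℂ] G) * star (gradingHalf S ν : G →L[ℂ] G) := rfl

lemma coe_gradingHalf : (gradingHalf S ν : G →L[ℂ] G) =
    (2⁻¹ : ℂ) • (1 + gradingUnitary S ν) - (Complex.I * 2⁻¹) • (1 - gradingUnitary S ν) := rfl

lemma star_gradingHalf : star (gradingHalf S ν : G →L[ℂ] G) =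
    (2⁻¹ : ℂ) • (1 + gradingUnitary S ν) + (Complex.I * 2⁻¹) • (1 - gradingUnitary S ν) := by
  simp [coe_gradingHalf, star_gradingUnitary S ν]

lemma klein_aut (b : B.commutant.toStarSubalgebra) :
    klein S ν ((commutantGrading S ν).aut b) = (twistedGrading S ν).aut (klein S ν b) := by
  apply Subtype.ext
  rw [coe_klein, coe_twistedGrading, coe_klein, coe_commutantGrading]
  have h1 := (gradingHalf_commute S ν).eq
  have h2 : star (gradingHalf S ν : G →L[ℂ] G) * gradingUnitary S ν =
      gradingUnitary S ν * star (gradingHalf S ν : G →L[ℂ] G) := by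
    have := congrArg star h1
    simpa [star_gradingUnitary S ν] using this
  simp only [← mul_assoc]
  rw [h1]
  simp only [mul_assoc]
  rw [h2]

lemma klein_surjective : Function.Surjective (klein S ν) := by
  rintro ⟨x, y, hy, rfl⟩
  exact ⟨⟨y, hy⟩, rfl⟩

lemma gradingUnitary_mul_of_mem_zero {b : B.commutant.toStarSubalgebra}
    (hb : b ∈ (commutantGrading S ν).part 0) :
    gradingUnitary S ν * (b : G →L[ℂ] G) = (b : G →L[ℂ] G) * gradingUnitary S ν := by
  rw [Grading.mem_part_zero] at hb
  have h := congrArg (Subtype.val) hb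
  rw [coe_commutantGrading] at h
  have h' := congrArg (fun x => x * gradingUnitary S ν) h
  simpa only [mul_assoc, gradingUnitary_mul_self S ν, mul_one] using h'

lemma klein_of_mem_zero {b : B.commutant.toStarSubalgebra}
    (hb : b ∈ (commutantGrading S ν).part 0) :
    (klein S ν b : G →L[ℂ] G) = b := by
  have hc : Commute (gradingUnitary S ν) (b : G →L[ℂ] G) := gradingUnitary_mul_of_mem_zero S ν hb
  have hc' : Commute (gradingHalf S ν : G →L[ℂ] G) (b : G →L[ℂ] G) := by
    rw [coe_gradingHalf]
    exact (((Commute.one_left _).add_left hc).smul_left _).sub_left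
      (((Commute.one_left _).sub_left hc).smul_left _)
  rw [coe_klein, hc'.eq, mul_assoc, Unitary.mul_star_self_of_mem (gradingHalf S ν).2, mul_one]

lemma gradingUnitary_mul_of_mem_one {b : B.commutant.toStarSubalgebra}
    (hb : b ∈ (commutantGrading S ν).part 1) :
    gradingUnitary S ν * (b : G →L[ℂ] G) = -((b : G →L[ℂ] G) * gradingUnitary S ν) := by
  rw [Grading.mem_part_one] at hb
  have h := congrArg (Subtype.val) hb
  rw [coe_commutantGrading] at h
  have h' := congrArg (fun x => x * gradingUnitary S ν) h
  simp only [mul_assoc, gradingUnitary_mul_self S ν, mul_one] at h'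
  rw [h']
  simp

lemma klein_of_mem_one {b : B.commutant.toStarSubalgebra}
    (hb : b ∈ (commutantGrading S ν).part 1) :
    (klein S ν b : G →L[ℂ] G) = -Complex.I • ((b : G →L[ℂ] G) * gradingUnitary S ν) := by
  have h1 := gradingUnitary_mul_of_mem_one S ν hb
  have hg := gradingUnitary_mul_self S ν
  have h2 : (gradingHalf S ν : G →L[ℂ] G) * (b : G →L[ℂ] G) =
      -Complex.I • ((b : G →L[ℂ] G) * star (gradingHalf S ν : G →L[ℂ] G)) := by
    rw [star_gradingHalf, coe_gradingHalf]
    simp only [sub_mul, add_mul, smul_mul_assoc, h1, mul_add, mul_smul_comm, mul_sub, one_mul,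
      mul_one]
    match_scalars
    · linear_combination (2⁻¹ : ℂ) * Complex.I_mul_I
    · linear_combination (-2⁻¹ : ℂ) * Complex.I_mul_I
  have h3 : star (gradingHalf S ν : G →L[ℂ] G) * star (gradingHalf S ν : G →L[ℂ] G) =
      gradingUnitary S ν := by
    rw [star_gradingHalf]
    simp only [sub_mul, add_mul, smul_mul_assoc, mul_add, mul_smul_comm, mul_sub, one_mul,
      mul_one, hg]
    match_scalars
    · linear_combination (2⁻¹ : ℂ) * Complex.I_mul_I
    · linear_combination (-2⁻¹ : ℂ) * Complex.I_mul_I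
  rw [coe_klein, h2, smul_mul_assoc, mul_assoc, h3]

/-- The linear bijection `B' → B^≀` with `b' ↦ b'` for even `b'` and `b' ↦ b' g` for odd `b'`.
Unlike the Klein isomorphism it does not change the action on the vector `Λ_ν`. -/
noncomputable def untwist : B.commutant.toStarSubalgebra →ₗ[ℂ] twistedCommutant S ν :=
  klein S ν ∘ₗ ((commutantGrading S ν).evenPart + Complex.I • (commutantGrading S ν).oddPart)

lemma untwist_of_mem_zero {b : B.commutant.toStarSubalgebra}
    (hb : b ∈ (commutantGrading S ν).part 0) :
    (untwist S ν b : G →L[ℂ] G) = b := by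
  simp [untwist, Grading.evenPart_of_mem_zero _ hb, Grading.oddPart_of_mem_zero _ hb,
    klein_of_mem_zero S ν hb]

lemma untwist_of_mem_one {b : B.commutant.toStarSubalgebra}
    (hb : b ∈ (commutantGrading S ν).part 1) :
    (untwist S ν b : G →L[ℂ] G) = (b : G →L[ℂ] G) * gradingUnitary S ν := by
  simp [untwist, Grading.evenPart_of_mem_one _ hb, Grading.oddPart_of_mem_one _ hb,
    klein_of_mem_one S ν hb, smul_smul]

lemma untwist_aut (b : B.commutant.toStarSubalgebra) :
    untwist S ν ((commutantGrading S ν).aut b) = (twistedGrading S ν).aut (untwist S ν b) := by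
  change klein S ν (((commutantGrading S ν).evenPart + Complex.I • (commutantGrading S ν).oddPart)
    ((commutantGrading S ν).aut b)) = _
  rw [untwist, LinearMap.comp_apply, ← klein_aut]
  congr 1
  simp [Grading.evenPart, Grading.oddPart]

lemma untwist_mem_part {i : ZMod 2} {b : B.commutant.toStarSubalgebra}
    (hb : b ∈ (commutantGrading S ν).part i) : untwist S ν b ∈ (twistedGrading S ν).part i := by
  rw [Grading.mem_part] at *
  rw [← untwist_aut, hb, map_smul]

lemma untwist_one : untwist S ν 1 = 1 :=
  Subtype.ext (untwist_of_mem_zero S ν (SetLike.GradedOne.one_mem))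

lemma untwist_surjective : Function.Surjective (untwist S ν) := by
  refine (klein_surjective S ν).comp fun b => ?_
  have he := (commutantGrading S ν).evenPart_mem b
  have ho := (commutantGrading S ν).oddPart_mem b
  refine ⟨(commutantGrading S ν).evenPart b - Complex.I • (commutantGrading S ν).oddPart b, ?_⟩
  simp only [LinearMap.add_apply, LinearMap.smul_apply, map_sub, map_smul,
    Grading.evenPart_of_mem_zero _ he, Grading.evenPart_of_mem_one _ ho,
    Grading.oddPart_of_mem_zero _ he, Grading.oddPart_of_mem_one _ ho]
  simp [smul_smul, Grading.evenPart_add_oddPart]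

lemma untwist_vec (b : B.commutant.toStarSubalgebra) :
    (untwist S ν b : G →L[ℂ] G) (vec S ν) = (b : G →L[ℂ] G) (vec S ν) := by
  rw [← (commutantGrading S ν).evenPart_add_oddPart b, map_add]
  have he := (commutantGrading S ν).evenPart_mem b
  have ho := (commutantGrading S ν).oddPart_mem b
  change (untwist S ν _ : G →L[ℂ] G) (vec S ν) + (untwist S ν _ : G →L[ℂ] G) (vec S ν) =
    (((commutantGrading S ν).evenPart b : G →L[ℂ] G)) (vec S ν) +
      ((commutantGrading S ν).oddPart b : G →L[ℂ] G) (vec S ν)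
  rw [untwist_of_mem_zero S ν he, untwist_of_mem_one S ν ho, mul_apply_eq_comp,
    gradingUnitary_vec]

/-- The map `untwist` is a `*`-homomorphism up to the sign that comes from moving `g` past an
odd element. -/
lemma star_untwist_mul_untwist {j l : ZMod 2} {b c : B.commutant.toStarSubalgebra}
    (hb : b ∈ (commutantGrading S ν).part j) (hc : c ∈ (commutantGrading S ν).part l) :
    star (untwist S ν b) * untwist S ν c =
      (-1 : ℤˣ) ^ (j * (j + l)) • untwist S ν (star b * c) := by
  have hbc := SetLike.mul_mem_graded ((commutantGrading S ν).star_mem_part hb) hc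
  have hsb := (commutantGrading S ν).star_mem_part hb
  have hg := gradingUnitary_mul_self S ν
  have hsg := star_gradingUnitary S ν
  have hcases : ∀ j : ZMod 2, j = 0 ∨ j = 1 := by decide
  apply Subtype.ext
  have hl : ((star (untwist S ν b) * untwist S ν c : twistedCommutant S ν) : G →L[ℂ] G) =
      star (untwist S ν b : G →L[ℂ] G) * (untwist S ν c : G →L[ℂ] G) := rfl
  have h11 : (1 : ZMod 2) + 1 = 0 := rfl
  rw [hl]
  rcases hcases j with rfl | rfl <;> rcases hcases l with rfl | rfl
  · rw [untwist_of_mem_zero S ν hb, untwist_of_mem_zero S ν hc]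
    simp [untwist_of_mem_zero S ν hbc]
  · rw [untwist_of_mem_zero S ν hb, untwist_of_mem_one S ν hc]
    rw [zero_add] at hbc
    simp [untwist_of_mem_one S ν hbc, mul_assoc]
  · have hgb := gradingUnitary_mul_of_mem_one S ν hsb
    rw [add_zero] at hbc
    have hgc := gradingUnitary_mul_of_mem_zero S ν hc
    rw [untwist_of_mem_one S ν hb, untwist_of_mem_zero S ν hc]
    have hgb' : gradingUnitary S ν * star (b : G →L[ℂ] G) =
      -(star (b : G →L[ℂ] G) * gradingUnitary S ν) := hgb
    simp [untwist_of_mem_one S ν hbc, hsg, hgb', mul_assoc, hgc]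
  · have hgb := gradingUnitary_mul_of_mem_one S ν hsb
    have hgc := gradingUnitary_mul_of_mem_one S ν hc
    rw [h11] at hbc
    rw [untwist_of_mem_one S ν hb, untwist_of_mem_one S ν hc]
    have hgb' : gradingUnitary S ν * star (b : G →L[ℂ] G) =
      -(star (b : G →L[ℂ] G) * gradingUnitary S ν) := hgb
    rw [star_mul, hsg, hgb', neg_mul, mul_assoc, ← mul_assoc (gradingUnitary S ν), hgc]
    simp [untwist_of_mem_zero S ν hbc, h11, mul_assoc, hg]

end Klein

/-! ### The usual plan of a fermionic plan -/

section UsualPlan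

variable {H : Type*} [NormedAddCommGroup H] [InnerProductSpace ℂ H] [CompleteSpace H]
variable {G : Type*} [NormedAddCommGroup G] [InnerProductSpace ℂ G] [CompleteSpace G]
variable {A : VonNeumannAlgebra H} {γA : Grading A.toStarSubalgebra}
variable {B : VonNeumannAlgebra G} {γB : Grading B.toStarSubalgebra}
variable (S : StandardForm B) {μ : EvenState γA} (ν : EvenState γB)

lemma hOp_ftmul (a : A.toStarSubalgebra) (b : twistedCommutant S ν) :
    hOp γA S ν (ftmul γA (twistedGrading S ν) a b) =
      ftmul γA (twistedGrading S ν) (γA.aut a) ((twistedGrading S ν).aut b) := rfl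

lemma ftmul_one_one : ftmul γA (twistedGrading S ν) 1 1 = 1 := rfl

lemma hHalf_one : hHalf γA S ν 1 = 1 := by
  have h : hOp γA S ν 1 = 1 := by
    rw [← ftmul_one_one, hOp_ftmul, map_one, map_one]
  simp only [hHalf, LinearMap.sub_apply, LinearMap.smul_apply, LinearMap.add_apply,
    Module.End.one_apply, h, sub_self, smul_zero, sub_zero, smul_add, ← add_smul]
  norm_num

lemma hHalfInv_ftmul_one (b : twistedCommutant S ν) :
    hHalfInv γA S ν (ftmul γA (twistedGrading S ν) 1 b) =
      ftmul γA (twistedGrading S ν) 1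
        ((twistedGrading S ν).evenPart b + Complex.I • (twistedGrading S ν).oddPart b) := by
  simp only [hHalfInv, LinearMap.add_apply, LinearMap.sub_apply, LinearMap.smul_apply,
    Module.End.one_apply, hOp_ftmul, map_one, Grading.evenPart, Grading.oddPart,
    LinearMap.id_apply, Grading.lin_apply, smul_smul, ftmul, TensorProduct.tmul_add,
    TensorProduct.tmul_sub, TensorProduct.tmul_smul, map_add, map_sub, map_smul]

lemma klein_evenPart_add (b : B.commutant.toStarSubalgebra) :
    (twistedGrading S ν).evenPart (klein S ν b) +
      Complex.I • (twistedGrading S ν).oddPart (klein S ν b) = untwist S ν b := by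
  simp [untwist, Grading.evenPart, Grading.oddPart, klein_aut]

lemma ftmul_one_mul_one_ftmul (a : A.toStarSubalgebra) (b : twistedCommutant S ν) :
    ftmul γA (twistedGrading S ν) a 1 * ftmul γA (twistedGrading S ν) 1 b =
      ftmul γA (twistedGrading S ν) a b :=
  GradedTensorProduct.tmul_one_mul_one_tmul _ _ a b

/-- The two Klein twists in the definition of `ω_⊙` cancel on the cyclic vector, up to
replacing odd `b'` by `b' g`. -/
theorem usualPlan_tmul (ω : Fermi γA (twistedGrading S ν) →ₗ[ℂ] ℂ) (a : A.toStarSubalgebra)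
    (b : B.commutant.toStarSubalgebra) :
    usualPlan S ν ω (a ⊗ₜ[ℂ] b) = ω (ftmul γA (twistedGrading S ν) a (untwist S ν b)) := by
  have h : usualPlan S ν ω (a ⊗ₜ[ℂ] b) = ω (ftmul γA (twistedGrading S ν) a 1 *
      hHalfInv γA S ν (ftmul γA (twistedGrading S ν) 1 (klein S ν b) * hHalf γA S ν 1)) := rfl
  rw [h, hHalf_one, mul_one, hHalfInv_ftmul_one, klein_evenPart_add, ftmul_one_mul_one_ftmul]

/-- The linear map `A ⊙ B' → A ⊠ B^≀` with `a ⊙ b' ↦ a ⊠ untwist b'`. -/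
noncomputable def tensorUntwist (γA : Grading A.toStarSubalgebra) :
    A.toStarSubalgebra ⊗[ℂ] B.commutant.toStarSubalgebra →ₗ[ℂ] Fermi γA (twistedGrading S ν) :=
  (GradedTensorProduct.of ℂ γA.part (twistedGrading S ν).part).toLinearMap ∘ₗ
    TensorProduct.map LinearMap.id (untwist S ν)

lemma tensorUntwist_tmul (a : A.toStarSubalgebra) (b : B.commutant.toStarSubalgebra) :
    tensorUntwist S ν γA (a ⊗ₜ[ℂ] b) = ftmul γA (twistedGrading S ν) a (untwist S ν b) := rfl

variable {S ν}

/-- A plan vanishes on homogeneous elements of different degrees. -/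
lemma fermionicPlan_eq_zero {ω : Fermi γA (twistedGrading S ν) →ₗ[ℂ] ℂ}
    (hω : ω ∈ fermionicPlans μ S ν) {i j : ZMod 2} (hij : i ≠ j) {a : A.toStarSubalgebra}
    {b : twistedCommutant S ν} (ha : a ∈ γA.part i) (hb : b ∈ (twistedGrading S ν).part j) :
    ω (ftmul γA (twistedGrading S ν) a b) = 0 := by
  have h := hω.2.2.2 a b
  rw [Grading.mem_part] at ha hb
  rw [ha, hb] at h
  have hcases : ∀ j : ZMod 2, j = 0 ∨ j = 1 := by decide
  rcases hcases i with rfl | rfl <;> rcases hcases j with rfl | rfl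
  · exact absurd rfl hij
  · simp only [ZMod.val_zero, ZMod.val_one, pow_zero, pow_one, one_smul, neg_smul, ftmul,
      TensorProduct.tmul_neg, map_neg] at h
    exact self_eq_neg.1 h
  · simp only [ZMod.val_zero, ZMod.val_one, pow_zero, pow_one, one_smul, neg_smul, ftmul,
      TensorProduct.neg_tmul, map_neg] at h
    exact self_eq_neg.1 h.symm
  · exact absurd rfl hij

lemma ftmul_units_smul (u : ℤˣ) (a : A.toStarSubalgebra) (b : twistedCommutant S ν) :
    ftmul γA (twistedGrading S ν) a (u • b) = u • ftmul γA (twistedGrading S ν) a b := by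
  rcases Int.units_eq_one_or u with rfl | rfl
  · simp
  · rw [Units.neg_smul, one_smul, Units.neg_smul, one_smul, ftmul, TensorProduct.tmul_neg, map_neg]

/-- On homogeneous elements the signs of the Fermi product, of its involution and of `untwist`
cancel, unless the degrees differ and both sides vanish. -/
lemma usualPlan_star_tmul_mul_tmul {ω : Fermi γA (twistedGrading S ν) →ₗ[ℂ] ℂ}
    (hω : ω ∈ fermionicPlans μ S ν) {i j k l : ZMod 2} {a a' : A.toStarSubalgebra}
    {b b' : B.commutant.toStarSubalgebra} (ha : a ∈ γA.part i)
    (hb : b ∈ (commutantGrading S ν).part j) (ha' : a' ∈ γA.part k)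
    (hb' : b' ∈ (commutantGrading S ν).part l) :
    usualPlan S ν ω (star (a ⊗ₜ[ℂ] b) * (a' ⊗ₜ[ℂ] b')) =
      ω (star (tensorUntwist S ν γA (a ⊗ₜ[ℂ] b)) * tensorUntwist S ν γA (a' ⊗ₜ[ℂ] b')) := by
  have hub := untwist_mem_part S ν hb
  have haa := SetLike.mul_mem_graded (γA.star_mem_part ha) ha'
  have hbb := untwist_mem_part S ν
    (SetLike.mul_mem_graded ((commutantGrading S ν).star_mem_part hb) hb')
  rw [TensorProduct.star_tmul, Algebra.TensorProduct.tmul_mul_tmul, usualPlan_tmul,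
    tensorUntwist_tmul, tensorUntwist_tmul, fermi_star_ftmul γA _ ha hub, smul_mul_assoc,
    ftmul_mul_ftmul γA _ _ _ ((twistedGrading S ν).star_mem_part hub) ha',
    star_untwist_mul_untwist S ν hb hb', ftmul_units_smul, smul_smul, smul_smul]
  by_cases hdeg : i + k = j + l
  · have hsign : ∀ i j k l : ZMod 2, i + k = j + l →
        (-1 : ℤˣ) ^ (i * j) * (-1 : ℤˣ) ^ (j * k) * (-1 : ℤˣ) ^ (j * (j + l)) = 1 := by decide
    rw [hsign i j k l hdeg, one_smul]
  · have h0 := fermionicPlan_eq_zero hω hdeg haa hbb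
    rw [h0]
    rcases Int.units_eq_one_or
      ((-1 : ℤˣ) ^ (i * j) * (-1 : ℤˣ) ^ (j * k) * (-1 : ℤˣ) ^ (j * (j + l))) with h | h
    · rw [h, one_smul, h0]
    · rw [h, Units.neg_smul, one_smul, map_neg, h0, neg_zero]

lemma tensor_homogeneous_induction {X Y : Type*} [Ring X] [StarRing X] [Algebra ℂ X] [Ring Y]
    [StarRing Y] [Algebra ℂ Y] (γ : Grading X) (η : Grading Y) {P : X ⊗[ℂ] Y → Prop}
    (hadd : ∀ c d, P c → P d → P (c + d))
    (h : ∀ (i j : ZMod 2) (a : X) (b : Y), a ∈ γ.part i → b ∈ η.part j → P (a ⊗ₜ[ℂ] b))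
    (c : X ⊗[ℂ] Y) : P c := by
  induction c using TensorProduct.induction_on with
  | zero => simpa using h 0 0 0 0 (zero_mem _) (zero_mem _)
  | tmul a b =>
    rw [← γ.evenPart_add_oddPart a, ← η.evenPart_add_oddPart b, TensorProduct.add_tmul,
      TensorProduct.tmul_add, TensorProduct.tmul_add]
    exact hadd _ _
      (hadd _ _ (h _ _ _ _ (γ.evenPart_mem a) (η.evenPart_mem b))
        (h _ _ _ _ (γ.evenPart_mem a) (η.oddPart_mem b)))
      (hadd _ _ (h _ _ _ _ (γ.oddPart_mem a) (η.evenPart_mem b))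
        (h _ _ _ _ (γ.oddPart_mem a) (η.oddPart_mem b)))
  | add s t hs ht => exact hadd _ _ hs ht

lemma map_star_add_mul {R F : Type*} [NonUnitalSemiring R] [StarRing R] [FunLike F R ℂ]
    [AddMonoidHomClass F R ℂ] (φ : F) (x y d : R) :
    φ (star (x + y) * d) = φ (star x * d) + φ (star y * d) := by
  rw [star_add, add_mul, map_add]

lemma map_star_mul_add {R F : Type*} [NonUnitalSemiring R] [Star R] [FunLike F R ℂ]
    [AddMonoidHomClass F R ℂ] (φ : F) (c x y : R) :
    φ (star c * (x + y)) = φ (star c * x) + φ (star c * y) := by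
  rw [mul_add, map_add]

/-- The functional `ω_⊙` is obtained from `ω` by a map that preserves the inner products. -/
theorem usualPlan_star_mul {ω : Fermi γA (twistedGrading S ν) →ₗ[ℂ] ℂ}
    (hω : ω ∈ fermionicPlans μ S ν)
    (c d : A.toStarSubalgebra ⊗[ℂ] B.commutant.toStarSubalgebra) :
    usualPlan S ν ω (star c * d) =
      ω (star (tensorUntwist S ν γA c) * tensorUntwist S ν γA d) := by
  refine tensor_homogeneous_induction γA (commutantGrading S ν)
    (P := fun c => usualPlan S ν ω (star c * d) =
      ω (star (tensorUntwist S ν γA c) * tensorUntwist S ν γA d)) (fun x y hx hy => ?_)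
    (fun i j a b ha hb => ?_) c
  · have h1 := map_star_add_mul (usualPlan S ν ω) x y d
    have h2 := map_star_add_mul ω (tensorUntwist S ν γA x) (tensorUntwist S ν γA y)
      (tensorUntwist S ν γA d)
    have h3 : tensorUntwist S ν γA (x + y) = tensorUntwist S ν γA x + tensorUntwist S ν γA y :=
      map_add _ _ _
    rw [h3]
    exact h1.trans ((congrArg₂ _ hx hy).trans h2.symm)
  refine tensor_homogeneous_induction γA (commutantGrading S ν)
    (P := fun d => usualPlan S ν ω (star (a ⊗ₜ[ℂ] b) * d) =
      ω (star (tensorUntwist S ν γA (a ⊗ₜ[ℂ] b)) * tensorUntwist S ν γA d))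
    (fun x y hx hy => ?_) (fun k l a' b' ha' hb' => ?_) d
  · have h1 := map_star_mul_add (usualPlan S ν ω) (a ⊗ₜ[ℂ] b) x y
    have h2 := map_star_mul_add ω (tensorUntwist S ν γA (a ⊗ₜ[ℂ] b)) (tensorUntwist S ν γA x)
      (tensorUntwist S ν γA y)
    have h3 : tensorUntwist S ν γA (x + y) = tensorUntwist S ν γA x + tensorUntwist S ν γA y :=
      map_add _ _ _
    rw [h3]
    exact h1.trans ((congrArg₂ _ hx hy).trans h2.symm)
  · exact usualPlan_star_tmul_mul_tmul hω ha hb ha' hb'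

lemma isState_usualPlan {ω : Fermi γA (twistedGrading S ν) →ₗ[ℂ] ℂ}
    (hω : ω ∈ fermionicPlans μ S ν) : IsState (usualPlan S ν ω) where
  map_one := by
    rw [Algebra.TensorProduct.one_def, usualPlan_tmul, untwist_one]
    exact hω.1.map_one
  nonneg c := by
    rw [usualPlan_star_mul hω]
    exact hω.1.nonneg _

theorem usualPlan_mem_gradedPlans {ω : Fermi γA (twistedGrading S ν) →ₗ[ℂ] ℂ}
    (hω : ω ∈ fermionicPlans μ S ν) : usualPlan S ν ω ∈ gradedPlans μ S ν := by
  refine ⟨isState_usualPlan hω, fun a => ?_, fun b => ?_, fun a b => ?_⟩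
  · rw [usualPlan_tmul, untwist_one, hω.2.1]
  · rw [usualPlan_tmul, hω.2.2.1]
    change ⟪vec S ν, _⟫_ℂ = ⟪vec S ν, _⟫_ℂ
    rw [untwist_vec]
  · rw [usualPlan_tmul, usualPlan_tmul, untwist_aut, hω.2.2.2]

end UsualPlan

/-! ### The channel of a graded plan -/

section Channel

variable {H : Type*} [NormedAddCommGroup H] [InnerProductSpace ℂ H] [CompleteSpace H]
variable {G : Type*} [NormedAddCommGroup G] [InnerProductSpace ℂ G] [CompleteSpace G]
variable {A : VonNeumannAlgebra H} {γA : Grading A.toStarSubalgebra}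
variable {B : VonNeumannAlgebra G} {γB : Grading B.toStarSubalgebra}

lemma StandardForm.norm_J (S : StandardForm B) (x : G) : ‖S.J x‖ = ‖x‖ := by
  have h := S.J_selfAdjoint x (S.J x)
  rw [S.J_sq, inner_self_eq_norm_sq_to_K, inner_self_eq_norm_sq_to_K] at h
  rw [← sq_eq_sq₀ (norm_nonneg _) (norm_nonneg _)]
  exact_mod_cast h

/-- The operator `J b J`. -/
noncomputable def StandardForm.conjJ (S : StandardForm B) (b : G →L[ℂ] G) : G →L[ℂ] G :=
  LinearMap.mkContinuous
    { toFun := fun x => S.J (b (S.J x))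
      map_add' := fun x y => by simp
      map_smul' := fun c x => by simp } ‖b‖ fun x => by
    change ‖S.J (b (S.J x))‖ ≤ _
    rw [S.norm_J, ← S.norm_J x]
    exact b.le_opNorm _

variable (S : StandardForm B) {μ : EvenState γA} (ν : EvenState γB)

/-- The map `b' ↦ b' Λ_ν` on the commutant. -/
noncomputable def commutantOrbit : B.commutant.toStarSubalgebra →ₗ[ℂ] G where
  toFun b := (b : G →L[ℂ] G) (vec S ν)
  map_add' _ _ := rfl
  map_smul' _ _ := rfl

lemma commutantOrbit_apply (b : B.commutant.toStarSubalgebra) :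
    commutantOrbit S ν b = (b : G →L[ℂ] G) (vec S ν) := rfl

/-- The vector `Λ_ν` is cyclic for `B' = J B J`, since `J` is isometric and fixes it. -/
lemma denseRange_commutantOrbit : DenseRange (commutantOrbit S ν) := by
  have hJ : Continuous S.J :=
    AddMonoidHomClass.continuous_of_bound S.J 1 fun x => by rw [S.norm_J, one_mul]
  have hsurj : Function.Surjective S.J := fun x => ⟨S.J x, S.J_sq x⟩
  refine (hsurj.denseRange.comp (dense_orbit S ν) hJ).mono ?_
  rintro _ ⟨b, rfl⟩
  refine ⟨⟨S.conjJ b, (S.J_conj _).2 ⟨b, b.2, fun x => rfl⟩⟩, ?_⟩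
  change S.J ((b : G →L[ℂ] G) (S.J (vec S ν))) = S.J ((b : G →L[ℂ] G) (vec S ν))
  rw [S.J_cone _ (vec_mem S ν)]

lemma inner_commutantOrbit (b c : B.commutant.toStarSubalgebra) :
    ⟪commutantOrbit S ν b, commutantOrbit S ν c⟫_ℂ =
      ⟪vec S ν, commutantOrbit S ν (star b * c)⟫_ℂ :=
  (ContinuousLinearMap.adjoint_inner_right (b : G →L[ℂ] G) (vec S ν) _).symm

lemma inner_commutantOrbit_left (T : B.toStarSubalgebra) (b c : B.commutant.toStarSubalgebra) :
    ⟪commutantOrbit S ν b, (T : G →L[ℂ] G) (commutantOrbit S ν c)⟫_ℂ =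
      ⟪vec S ν, (T : G →L[ℂ] G) (commutantOrbit S ν (star b * c))⟫_ℂ := by
  have h := (ContinuousLinearMap.adjoint_inner_right (b : G →L[ℂ] G) (vec S ν)
    ((T : G →L[ℂ] G) (commutantOrbit S ν c))).symm
  have hc := VonNeumannAlgebra.mem_commutant_iff.1 (star b).2 T T.2
  have hc' := congrArg (fun R : G →L[ℂ] G => R (commutantOrbit S ν c)) hc
  exact h.trans (congrArg (fun z => ⟪vec S ν, z⟫_ℂ) hc'.symm)

/-- An element of `B` is determined by the functional `b' ↦ ⟨Λ_ν, T b' Λ_ν⟩`. -/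
lemma ext_of_inner_vec {T R : B.toStarSubalgebra}
    (h : ∀ b, ⟪vec S ν, (T : G →L[ℂ] G) (commutantOrbit S ν b)⟫_ℂ =
      ⟪vec S ν, (R : G →L[ℂ] G) (commutantOrbit S ν b)⟫_ℂ) : T = R := by
  have hd := denseRange_commutantOrbit S ν
  refine Subtype.ext (ContinuousLinearMap.ext fun x => congrFun (hd.equalizer
    (T : G →L[ℂ] G).continuous (R : G →L[ℂ] G).continuous (funext fun c => ?_)) x)
  refine hd.eq_of_inner_right ℂ fun b => ?_
  simp only [Function.comp_apply]
  rw [inner_commutantOrbit_left, inner_commutantOrbit_left, h]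

variable {S ν}
variable {φ : A.toStarSubalgebra ⊗[ℂ] B.commutant.toStarSubalgebra →ₗ[ℂ] ℂ}

lemma gradedPlan_star_tmul_mul_tmul (a a' : A.toStarSubalgebra)
    (b b' : B.commutant.toStarSubalgebra) :
    φ (star (a ⊗ₜ[ℂ] b) * (a' ⊗ₜ[ℂ] b')) = φ ((star a * a') ⊗ₜ[ℂ] (star b * b')) := by
  rw [TensorProduct.star_tmul, Algebra.TensorProduct.tmul_mul_tmul]

lemma gradedPlan_nonneg (hφ : φ ∈ gradedPlans μ S ν) (a : A.toStarSubalgebra)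
    (b : B.commutant.toStarSubalgebra) : 0 ≤ φ ((star a * a) ⊗ₜ[ℂ] (star b * b)) := by
  rw [← gradedPlan_star_tmul_mul_tmul]
  exact hφ.1.nonneg _

lemma gradedPlan_one_tmul (hφ : φ ∈ gradedPlans μ S ν) (b c : B.commutant.toStarSubalgebra) :
    φ (1 ⊗ₜ[ℂ] (star b * c)) = ⟪commutantOrbit S ν b, commutantOrbit S ν c⟫_ℂ := by
  rw [inner_commutantOrbit, hφ.2.2.1]
  rfl

lemma gradedPlan_re_one_tmul (hφ : φ ∈ gradedPlans μ S ν) (b : B.commutant.toStarSubalgebra) :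
    (φ (1 ⊗ₜ[ℂ] (star b * b))).re = ‖commutantOrbit S ν b‖ ^ 2 := by
  rw [gradedPlan_one_tmul hφ, inner_self_eq_norm_sq_to_K]
  norm_cast

lemma gradedPlan_le_norm_left (hφ : φ ∈ gradedPlans μ S ν) (a : A.toStarSubalgebra)
    (b : B.commutant.toStarSubalgebra) :
    (φ ((star a * a) ⊗ₜ[ℂ] (star b * b))).re ≤
      ‖(a : H →L[ℂ] H)‖ ^ 2 * ‖commutantOrbit S ν b‖ ^ 2 := by
  obtain ⟨c, hc⟩ := exists_star_mul_self_add A a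
  have h1 := (Complex.nonneg_iff.1 (gradedPlan_nonneg hφ c b)).1
  have h2 : φ ((star a * a) ⊗ₜ[ℂ] (star b * b)) + φ ((star c * c) ⊗ₜ[ℂ] (star b * b)) =
      ((‖(a : H →L[ℂ] H)‖ ^ 2 : ℝ) : ℂ) * φ (1 ⊗ₜ[ℂ] (star b * b)) := by
    rw [← map_add, ← TensorProduct.add_tmul, hc, ← TensorProduct.smul_tmul', map_smul,
      smul_eq_mul]
  have h3 := congrArg Complex.re h2
  rw [Complex.add_re, Complex.re_ofReal_mul, gradedPlan_re_one_tmul hφ] at h3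
  linarith

lemma gradedPlan_le_norm_right (hφ : φ ∈ gradedPlans μ S ν) (a : A.toStarSubalgebra)
    (b : B.commutant.toStarSubalgebra) :
    (φ ((star a * a) ⊗ₜ[ℂ] (star b * b))).re ≤
      ‖(b : G →L[ℂ] G)‖ ^ 2 * (μ.toLin (star a * a)).re := by
  obtain ⟨c, hc⟩ := exists_star_mul_self_add B.commutant b
  have h1 := (Complex.nonneg_iff.1 (gradedPlan_nonneg hφ a c)).1
  have h2 : φ ((star a * a) ⊗ₜ[ℂ] (star b * b)) + φ ((star a * a) ⊗ₜ[ℂ] (star c * c)) =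
      ((‖(b : G →L[ℂ] G)‖ ^ 2 : ℝ) : ℂ) * φ ((star a * a) ⊗ₜ[ℂ] 1) := by
    rw [← map_add, ← TensorProduct.tmul_add, hc, TensorProduct.tmul_smul, map_smul,
      smul_eq_mul]
  have h3 := congrArg Complex.re h2
  rw [Complex.add_re, Complex.re_ofReal_mul, hφ.2.1] at h3
  linarith

/-- The Cauchy–Schwarz inequality for a plan on elementary tensors. -/
lemma gradedPlan_norm_sq_le (hφ : φ ∈ gradedPlans μ S ν) (a : A.toStarSubalgebra)
    (b c : B.commutant.toStarSubalgebra) :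
    ‖φ (a ⊗ₜ[ℂ] (star b * c))‖ ^ 2 ≤
      ‖commutantOrbit S ν b‖ ^ 2 * (φ ((star a * a) ⊗ₜ[ℂ] (star c * c))).re := by
  have h := norm_map_star_mul_sq_le hφ.1.nonneg (1 ⊗ₜ[ℂ] b) (a ⊗ₜ[ℂ] c)
  rw [gradedPlan_star_tmul_mul_tmul, gradedPlan_star_tmul_mul_tmul,
    gradedPlan_star_tmul_mul_tmul, star_one, one_mul, one_mul, gradedPlan_re_one_tmul hφ] at h
  exact h

lemma exists_operator_of_gradedPlan (hφ : φ ∈ gradedPlans μ S ν) (a : A.toStarSubalgebra) :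
    ∃ T : B.toStarSubalgebra, ∀ b,
      ⟪vec S ν, (T : G →L[ℂ] G) (commutantOrbit S ν b)⟫_ℂ = φ (a ⊗ₜ[ℂ] b) := by
  have hd := denseRange_commutantOrbit S ν
  obtain ⟨T, hT⟩ := exists_operator_of_form hd
    (starForm (φ ∘ₗ TensorProduct.mk ℂ A.toStarSubalgebra B.commutant.toStarSubalgebra a))
    (norm_nonneg (a : H →L[ℂ] H)) fun b c => by
      rw [starForm_apply, ← pow_le_pow_iff_left₀ (norm_nonneg _) (by positivity) two_ne_zero]
      calc ‖φ (a ⊗ₜ[ℂ] (star b * c))‖ ^ 2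
          ≤ ‖commutantOrbit S ν b‖ ^ 2 * (φ ((star a * a) ⊗ₜ[ℂ] (star c * c))).re :=
            gradedPlan_norm_sq_le hφ a b c
        _ ≤ ‖commutantOrbit S ν b‖ ^ 2 *
            (‖(a : H →L[ℂ] H)‖ ^ 2 * ‖commutantOrbit S ν c‖ ^ 2) := by
            gcongr
            exact gradedPlan_le_norm_left hφ a c
        _ = (‖(a : H →L[ℂ] H)‖ * ‖commutantOrbit S ν b‖ * ‖commutantOrbit S ν c‖) ^ 2 := by ring
  have hT' : ∀ b c, ⟪commutantOrbit S ν b, T (commutantOrbit S ν c)⟫_ℂ =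
      φ (a ⊗ₜ[ℂ] (star b * c)) := hT
  have hmem : T ∈ B := by
    rw [← B.commutant_commutant, VonNeumannAlgebra.mem_commutant_iff]
    intro z hz
    let z' : B.commutant.toStarSubalgebra := ⟨z, hz⟩
    refine ContinuousLinearMap.ext fun x => congrFun (hd.equalizer
      (z * T).continuous (T * z).continuous (funext fun c => ?_)) x
    refine hd.eq_of_inner_right ℂ fun b => ?_
    change ⟪_, z (T _)⟫_ℂ = ⟪_, T (z _)⟫_ℂ
    have e1 : z (commutantOrbit S ν c) = commutantOrbit S ν (z' * c) := rfl
    have e2 : ContinuousLinearMap.adjoint z (commutantOrbit S ν b) =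
      commutantOrbit S ν (star z' * b) := rfl
    have e3 : star (star z' * b) * c = star b * (z' * c) := by
      rw [star_mul, star_star, mul_assoc]
    rw [← ContinuousLinearMap.adjoint_inner_left, e1, e2, hT', hT', e3]
  refine ⟨⟨T, hmem⟩, fun b => ?_⟩
  have h := hT' 1 b
  rw [star_one, one_mul] at h
  exact h

/-- Every graded plan is of the form `δ_ν ∘ (E ⊙ id)`. -/
theorem exists_linearMap_of_gradedPlan (hφ : φ ∈ gradedPlans μ S ν) :
    ∃ E : A.toStarSubalgebra →ₗ[ℂ] B.toStarSubalgebra, ∀ a b,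
      ⟪vec S ν, (E a : G →L[ℂ] G) (commutantOrbit S ν b)⟫_ℂ = φ (a ⊗ₜ[ℂ] b) := by
  choose E hE using exists_operator_of_gradedPlan hφ
  refine ⟨⟨⟨E, fun a a' => ext_of_inner_vec S ν fun b => ?_⟩,
    fun r a => ext_of_inner_vec S ν fun b => ?_⟩, hE⟩
  · change _ = ⟪vec S ν, (E a : G →L[ℂ] G) _ + (E a' : G →L[ℂ] G) _⟫_ℂ
    rw [inner_add_right, hE, hE, hE, TensorProduct.add_tmul, map_add]
  · have h1 : φ ((r • a) ⊗ₜ[ℂ] b) = r * φ (a ⊗ₜ[ℂ] b) := by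
      rw [← TensorProduct.smul_tmul']
      exact map_smul φ r _
    have h2 : ⟪vec S ν, r • (E a : G →L[ℂ] G) (commutantOrbit S ν b)⟫_ℂ = r * φ (a ⊗ₜ[ℂ] b) :=
      (inner_smul_right _ _ _).trans (congrArg _ (hE a b))
    exact (hE _ b).trans (h1.trans h2.symm)

variable {E : A.toStarSubalgebra →ₗ[ℂ] B.toStarSubalgebra}

lemma inner_channel (hE : ∀ a b, ⟪vec S ν, (E a : G →L[ℂ] G) (commutantOrbit S ν b)⟫_ℂ =
      φ (a ⊗ₜ[ℂ] b)) (a : A.toStarSubalgebra) (b c : B.commutant.toStarSubalgebra) :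
    ⟪commutantOrbit S ν b, (E a : G →L[ℂ] G) (commutantOrbit S ν c)⟫_ℂ =
      φ (a ⊗ₜ[ℂ] (star b * c)) := by
  rw [inner_commutantOrbit_left, hE]

lemma channel_map_one (hφ : φ ∈ gradedPlans μ S ν)
    (hE : ∀ a b, ⟪vec S ν, (E a : G →L[ℂ] G) (commutantOrbit S ν b)⟫_ℂ = φ (a ⊗ₜ[ℂ] b)) :
    E 1 = 1 :=
  ext_of_inner_vec S ν fun b => by
    rw [hE, hφ.2.2.1]
    rfl

/-- On vectors `yᵢ Λ_ν` with `yᵢ ∈ B'`, complete positivity is the positivity of the plan at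
`∑ⱼ Tₖⱼ ⊙ yⱼ`; these vectors are dense. -/
lemma channel_completelyPositive (hφ : φ ∈ gradedPlans μ S ν)
    (hE : ∀ a b, ⟪vec S ν, (E a : G →L[ℂ] G) (commutantOrbit S ν b)⟫_ℂ = φ (a ⊗ₜ[ℂ] b)) :
    IsCompletelyPositive E := by
  intro n T x
  have hd : DenseRange (Pi.map fun _ : Fin n => (commutantOrbit S ν : _ → G)) :=
    DenseRange.piMap fun _ => denseRange_commutantOrbit S ν
  refine hd.induction_on (p := fun x => 0 ≤ ∑ i, ∑ j,
    ⟪x i, (E ((T.conjTranspose * T) i j) : G →L[ℂ] G) (x j)⟫_ℂ) x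
    (isClosed_le continuous_const (by fun_prop)) fun y => ?_
  have h : ∑ i, ∑ j, ⟪commutantOrbit S ν (y i),
      (E ((T.conjTranspose * T) i j) : G →L[ℂ] G) (commutantOrbit S ν (y j))⟫_ℂ =
      ∑ k, φ (star (∑ i, T k i ⊗ₜ[ℂ] y i) * ∑ j, T k j ⊗ₜ[ℂ] y j) := by
    have h1 : ∀ k, φ (star (∑ i, T k i ⊗ₜ[ℂ] y i) * ∑ j, T k j ⊗ₜ[ℂ] y j) =
        ∑ i, ∑ j, φ ((star (T k i) * T k j) ⊗ₜ[ℂ] (star (y i) * y j)) := by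
      intro k
      rw [star_sum, Finset.sum_mul, map_sum]
      refine Finset.sum_congr rfl fun i _ => ?_
      rw [Finset.mul_sum, map_sum]
      exact Finset.sum_congr rfl fun j _ => gradedPlan_star_tmul_mul_tmul _ _ _ _
    simp only [h1]
    conv_rhs => rw [Finset.sum_comm]
    refine Finset.sum_congr rfl fun i _ => ?_
    conv_rhs => rw [Finset.sum_comm]
    refine Finset.sum_congr rfl fun j _ => ?_
    rw [inner_channel hE, Matrix.mul_apply, TensorProduct.sum_tmul, map_sum]
    rfl
  change 0 ≤ ∑ i, ∑ j, ⟪commutantOrbit S ν (y i),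
      (E ((T.conjTranspose * T) i j) : G →L[ℂ] G) (commutantOrbit S ν (y j))⟫_ℂ
  rw [h]
  exact Finset.sum_nonneg fun k _ => hφ.1.nonneg _

lemma channel_aut (hφ : φ ∈ gradedPlans μ S ν)
    (hE : ∀ a b, ⟪vec S ν, (E a : G →L[ℂ] G) (commutantOrbit S ν b)⟫_ℂ = φ (a ⊗ₜ[ℂ] b))
    (a : A.toStarSubalgebra) : E (γA.aut a) = γB.aut (E a) :=
  ext_of_inner_vec S ν fun b => by
    rw [hE, hφ.2.2.2, ← hE, ← gradingUnitary_conj S ν]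
    have e1 : commutantOrbit S ν ((commutantGrading S ν).aut b) =
        gradingUnitary S ν (commutantOrbit S ν b) := by
      change gradingUnitary S ν ((b : G →L[ℂ] G) (gradingUnitary S ν (vec S ν))) = _
      rw [gradingUnitary_vec]
      rfl
    rw [e1]
    have h := ContinuousLinearMap.adjoint_inner_left (gradingUnitary S ν)
      ((E a : G →L[ℂ] G) (gradingUnitary S ν (commutantOrbit S ν b))) (vec S ν)
    rw [← ContinuousLinearMap.star_eq_adjoint, star_gradingUnitary, gradingUnitary_vec] at h
    exact h

lemma state_channel (hφ : φ ∈ gradedPlans μ S ν)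
    (hE : ∀ a b, ⟪vec S ν, (E a : G →L[ℂ] G) (commutantOrbit S ν b)⟫_ℂ = φ (a ⊗ₜ[ℂ] b))
    (a : A.toStarSubalgebra) : ν.toLin (E a) = μ.toLin a := by
  rw [vec_spec S ν, ← hφ.2.1, ← hE]
  rfl

end Channel

/-! ### The amplified representation and normality -/

section Amplification

variable {H : Type*} [NormedAddCommGroup H]

variable (H) in
/-- The Hilbert space `ℓ²(ℕ, H)`, whose vector functionals are the elementary `σ`-weakly
continuous functionals on operators on `H`. -/
abbrev EllTwo : Type _ := lp (fun _ : ℕ => H) 2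

lemma memℓp_two_iff {f : ℕ → H} : Memℓp f 2 ↔ Summable fun n => ‖f n‖ ^ 2 := by
  rw [memℓp_gen_iff (by norm_num)]
  norm_num

lemma hasSum_norm_sq (ξ : EllTwo H) : HasSum (fun n => ‖ξ n‖ ^ 2) (‖ξ‖ ^ 2) := by
  have h := lp.hasSum_norm (p := 2) (by norm_num) ξ
  norm_num at h
  exact h

variable [InnerProductSpace ℂ H]

/-- The amplification `t ⊗ 1` to `ℓ²(ℕ, H)` of an operator `t` on `H`. -/
noncomputable def amp (t : H →L[ℂ] H) : EllTwo H →L[ℂ] EllTwo H :=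
  lp.mapCLM 2 (fun _ => t) (norm_nonneg t) fun _ => le_rfl

lemma norm_amp_smul_sq {c : ℝ} (hc : 0 ≤ c) (t : H →L[ℂ] H) (ξ : EllTwo H) :
    ‖amp t ((Real.sqrt c : ℂ) • ξ)‖ ^ 2 = c * ‖amp t ξ‖ ^ 2 := by
  rw [map_smul, norm_smul, mul_pow, Complex.norm_real, Real.norm_of_nonneg (Real.sqrt_nonneg c),
    Real.sq_sqrt hc]

lemma tsum_inner_eq_inner_amp (t : H →L[ℂ] H) (ξ η : EllTwo H) :
    ∑' n, ⟪ξ n, t (η n)⟫_ℂ = ⟪ξ, amp t η⟫_ℂ := (lp.inner_eq_tsum ξ (amp t η)).symm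

/-- A square-summable sequence of vectors of `ℓ²(ℕ, H)`, rearranged into one vector. -/
lemma exists_hasSum_norm_amp_sq {ξ : ℕ → EllTwo H} (hξ : Summable fun k => ‖ξ k‖ ^ 2) :
    ∃ Ξ : EllTwo H, ∀ t, HasSum (fun k => ‖amp t (ξ k)‖ ^ 2) (‖amp t Ξ‖ ^ 2) := by
  have hsum : Summable fun p : ℕ × ℕ => ‖ξ p.1 p.2‖ ^ 2 := by
    rw [summable_prod_of_nonneg fun p => by positivity]
    refine ⟨fun k => (hasSum_norm_sq (ξ k)).summable, ?_⟩
    simpa only [(hasSum_norm_sq (ξ _)).tsum_eq] using hξ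
  let Ξ : EllTwo H := ⟨fun m => ξ (Nat.pairEquiv.symm m).1 (Nat.pairEquiv.symm m).2,
    memℓp_two_iff.2 ((Nat.pairEquiv.symm.summable_iff
      (f := fun p : ℕ × ℕ => ‖ξ p.1 p.2‖ ^ 2)).2 hsum)⟩
  refine ⟨Ξ, fun t => ?_⟩
  have h1 : HasSum ((fun p : ℕ × ℕ => ‖t (ξ p.1 p.2)‖ ^ 2) ∘ Nat.pairEquiv.symm)
      (‖amp t Ξ‖ ^ 2) := hasSum_norm_sq (amp t Ξ)
  rw [Nat.pairEquiv.symm.hasSum_iff] at h1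
  exact h1.prod_fiberwise fun k => hasSum_norm_sq (amp t (ξ k))

variable [CompleteSpace H]

variable (H) in
/-- Amplification as a `*`-homomorphism. -/
noncomputable def ampHom : (H →L[ℂ] H) →⋆ₐ[ℂ] (EllTwo H →L[ℂ] EllTwo H) where
  toFun := amp
  map_one' := by ext; rfl
  map_mul' s t := by ext; rfl
  map_zero' := by ext; rfl
  map_add' s t := by ext; rfl
  commutes' r := by ext; rfl
  map_star' t := by
    rw [ContinuousLinearMap.star_eq_adjoint, ContinuousLinearMap.star_eq_adjoint,
      ContinuousLinearMap.eq_adjoint_iff]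
    intro x y
    rw [lp.inner_eq_tsum, lp.inner_eq_tsum]
    exact tsum_congr fun n => ContinuousLinearMap.adjoint_inner_left t _ _

lemma amp_one : amp (1 : H →L[ℂ] H) = 1 := map_one (ampHom H)

lemma amp_star_mul (s t : H →L[ℂ] H) : amp (star s * t) = star (amp s) * amp t := by
  change ampHom H (star s * t) = star (ampHom H s) * ampHom H t
  rw [map_mul, map_star]

lemma amp_smul (c : ℂ) (t : H →L[ℂ] H) : amp (c • t) = c • amp t := map_smul (ampHom H) c t

lemma inner_amp_star_mul (s t : H →L[ℂ] H) (ξ η : EllTwo H) :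
    ⟪ξ, amp (star s * t) η⟫_ℂ = ⟪amp s ξ, amp t η⟫_ℂ := by
  rw [amp_star_mul, mul_apply_eq_comp, ContinuousLinearMap.star_eq_adjoint,
    ContinuousLinearMap.adjoint_inner_right]

lemma exists_norm_amp_sq_eq_add (ξ η : EllTwo H) :
    ∃ Ξ : EllTwo H, ∀ t, ‖amp t Ξ‖ ^ 2 = ‖amp t ξ‖ ^ 2 + ‖amp t η‖ ^ 2 := by
  let f : ℕ → EllTwo H := fun k => if k = 0 then ξ else if k = 1 then η else 0
  have hf : ∀ k ∉ Finset.range 2, f k = 0 := fun k hk => by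
    simp only [Finset.mem_range, not_lt] at hk
    simp only [f]
    rw [if_neg (by omega), if_neg (by omega)]
  have hs : ∀ t : H →L[ℂ] H, HasSum (fun k => ‖amp t (f k)‖ ^ 2)
      (∑ k ∈ Finset.range 2, ‖amp t (f k)‖ ^ 2) := fun t =>
    hasSum_sum_of_ne_finset_zero fun k hk => by simp [hf k hk]
  obtain ⟨Ξ, hΞ⟩ := exists_hasSum_norm_amp_sq (ξ := f) (by simpa [amp_one] using (hs 1).summable)
  refine ⟨Ξ, fun t => ((hΞ t).unique (hs t)).trans ?_⟩
  simp [f, Finset.sum_range_succ]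

lemma exists_norm_amp_sq_eq_sum {ι : Type*} (s : Finset ι) (ξ : ι → EllTwo H) :
    ∃ Ξ : EllTwo H, ∀ t, ‖amp t Ξ‖ ^ 2 = ∑ i ∈ s, ‖amp t (ξ i)‖ ^ 2 := by
  classical
  induction s using Finset.induction_on with
  | empty => exact ⟨0, fun t => by simp⟩
  | insert i s hi ih =>
    obtain ⟨Ξ, hΞ⟩ := ih
    obtain ⟨Ξ', hΞ'⟩ := exists_norm_amp_sq_eq_add (ξ i) Ξ
    exact ⟨Ξ', fun t => by rw [hΞ', hΞ, Finset.sum_insert hi]⟩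

lemma continuous_sigmaWeak_inner_amp (M : StarSubalgebra ℂ (H →L[ℂ] H)) (ξ η : EllTwo H) :
    Continuous[sigmaWeak M, inferInstance] fun a : M => ⟪ξ, amp (a : H →L[ℂ] H) η⟫_ℂ := by
  simp only [← tsum_inner_eq_inner_amp]
  exact continuous_iInf_dom (i := ⟨(ξ, η), memℓp_two_iff.1 ξ.2, memℓp_two_iff.1 η.2⟩)
    continuous_induced_dom

/-- A `σ`-weakly continuous functional is bounded on positive elements by a vector functional of
the amplified representation: it is bounded by finitely many of the functionals that define the
topology, and `|⟨ξ, a* a η⟩| ≤ ‖a ξ‖ ‖a η‖`. -/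
theorem exists_norm_map_star_mul_self_le {M : StarSubalgebra ℂ (H →L[ℂ] H)} {φ : M →ₗ[ℂ] ℂ}
    (hφ : Continuous[sigmaWeak M, inferInstance] φ) :
    ∃ ζ : EllTwo H, ∀ a : M, ‖φ (star a * a)‖ ≤ ‖amp (a : H →L[ℂ] H) ζ‖ ^ 2 := by
  classical
  have h1 : φ ⁻¹' Metric.ball 0 1 ∈ @nhds M (sigmaWeak M) 0 := by
    refine @ContinuousAt.preimage_mem_nhds _ _ (sigmaWeak M) _ _ _ _
      (@Continuous.continuousAt _ _ (sigmaWeak M) _ _ _ hφ) ?_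
    rw [map_zero]
    exact Metric.ball_mem_nhds _ one_pos
  rw [nhds_iInf, Filter.mem_iInf] at h1
  obtain ⟨I, hI, V, hV, hφV⟩ := h1
  -- each of the finitely many neighbourhoods contains the set where the functional is small
  have h2 : ∀ i : I, ∃ δ > 0, ∀ a : M,
      ‖∑' n, ⟪i.1.1.1 n, (a : H →L[ℂ] H) (i.1.1.2 n)⟫_ℂ‖ < δ → a ∈ V i := by
    intro i
    have := hV i
    rw [nhds_induced, Filter.mem_comap] at this
    obtain ⟨t, ht, htV⟩ := this
    obtain ⟨δ, hδ, hδt⟩ := Metric.mem_nhds_iff.1 ht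
    refine ⟨δ, hδ, fun a ha => htV (hδt ?_)⟩
    simpa using ha
  choose δ hδ hδV using h2
  have := hI.fintype
  let ξ : I → EllTwo H := fun i => ⟨i.1.1.1, memℓp_two_iff.2 i.1.2.1⟩
  let η : I → EllTwo H := fun i => ⟨i.1.1.2, memℓp_two_iff.2 i.1.2.2⟩
  have h3 : ∀ (i : I) (a : M), ‖⟪ξ i, amp (a : H →L[ℂ] H) (η i)⟫_ℂ‖ < δ i → a ∈ V i :=
    fun i a ha => hδV i a (by rwa [← tsum_inner_eq_inner_amp] at ha)
  -- the bound follows from the inclusion of neighbourhoods of `0` by scaling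
  have h4 : ∀ a : M, ‖φ a‖ ≤ ∑ i, (δ i)⁻¹ * ‖⟪ξ i, amp (a : H →L[ℂ] H) (η i)⟫_ℂ‖ := by
    intro a
    by_contra! hlt
    set r := ∑ i, (δ i)⁻¹ * ‖⟪ξ i, amp (a : H →L[ℂ] H) (η i)⟫_ℂ‖ with hr
    have hr0 : 0 ≤ r := Finset.sum_nonneg fun i _ =>
      mul_nonneg (inv_nonneg.2 (hδ i).le) (norm_nonneg _)
    have hm : 0 < ‖φ a‖ := hr0.trans_lt hlt
    have hb : ((‖φ a‖⁻¹ : ℝ) : ℂ) • a ∈ φ ⁻¹' Metric.ball 0 1 := by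
      rw [hφV, Set.mem_iInter]
      intro i
      refine h3 i _ ?_
      have hi : (δ i)⁻¹ * ‖⟪ξ i, amp (a : H →L[ℂ] H) (η i)⟫_ℂ‖ ≤ r :=
        Finset.single_le_sum (f := fun i => (δ i)⁻¹ * ‖⟪ξ i, amp (a : H →L[ℂ] H) (η i)⟫_ℂ‖)
          (fun i _ => mul_nonneg (inv_nonneg.2 (hδ i).le) (norm_nonneg _)) (Finset.mem_univ i)
      have hi' := hi.trans_lt hlt
      rw [inv_mul_lt_iff₀ (hδ i)] at hi'
      have hs : ((((‖φ a‖⁻¹ : ℝ) : ℂ) • a : M) : H →L[ℂ] H) =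
        ((‖φ a‖⁻¹ : ℝ) : ℂ) • (a : H →L[ℂ] H) := rfl
      rw [hs, amp_smul, smul_apply, inner_smul_right, norm_mul,
        Complex.norm_real, norm_inv, norm_norm, inv_mul_lt_iff₀ hm, mul_comm]
      linarith
    rw [Set.mem_preimage, mem_ball_zero_iff, map_smul, norm_smul, Complex.norm_real, norm_inv,
      norm_norm, inv_mul_cancel₀ hm.ne'] at hb
    exact lt_irrefl _ hb
  have h5 : ∀ i, ∃ ζ : EllTwo H, ∀ t, ‖amp t ζ‖ ^ 2 =
      (δ i)⁻¹ * ‖amp t (ξ i)‖ ^ 2 + (δ i)⁻¹ * ‖amp t (η i)‖ ^ 2 := by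
    intro i
    obtain ⟨ζ, hζ⟩ := exists_norm_amp_sq_eq_add ((Real.sqrt (δ i)⁻¹ : ℂ) • ξ i)
      ((Real.sqrt (δ i)⁻¹ : ℂ) • η i)
    have h0 : 0 ≤ (δ i)⁻¹ := inv_nonneg.2 (hδ i).le
    exact ⟨ζ, fun t => by rw [hζ, norm_amp_smul_sq h0, norm_amp_smul_sq h0]⟩
  choose ζ hζ using h5
  obtain ⟨Z, hZ⟩ := exists_norm_amp_sq_eq_sum Finset.univ ζ
  refine ⟨Z, fun a => (h4 (star a * a)).trans ?_⟩
  rw [hZ]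
  refine Finset.sum_le_sum fun i _ => ?_
  rw [hζ, ← mul_add]
  refine mul_le_mul_of_nonneg_left ?_ (inv_nonneg.2 (hδ i).le)
  have hs : ((star a * a : M) : H →L[ℂ] H) = star (a : H →L[ℂ] H) * (a : H →L[ℂ] H) := rfl
  rw [hs, inner_amp_star_mul]
  refine (norm_inner_le_norm _ _).trans ?_
  nlinarith [sq_nonneg (‖amp (a : H →L[ℂ] H) (ξ i)‖ - ‖amp (a : H →L[ℂ] H) (η i)‖),
    sq_nonneg (‖amp (a : H →L[ℂ] H) (ξ i)‖ + ‖amp (a : H →L[ℂ] H) (η i)‖)]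

end Amplification

/-! ### Normality of the channel -/

section Normality

variable {H : Type*} [NormedAddCommGroup H] [InnerProductSpace ℂ H] [CompleteSpace H]
variable {G : Type*} [NormedAddCommGroup G] [InnerProductSpace ℂ G] [CompleteSpace G]
variable {A : VonNeumannAlgebra H} {γA : Grading A.toStarSubalgebra}
variable {B : VonNeumannAlgebra G} {γB : Grading B.toStarSubalgebra}
variable {S : StandardForm B} {μ : EvenState γA} {ν : EvenState γB}
variable {φ : A.toStarSubalgebra ⊗[ℂ] B.commutant.toStarSubalgebra →ₗ[ℂ] ℂ}
variable {E : A.toStarSubalgebra →ₗ[ℂ] B.toStarSubalgebra}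

/-- A bound on the matrix entries against a dense set of vectors is a bound on the norm. -/
lemma norm_le_of_denseRange_inner {K ι : Type*} [NormedAddCommGroup K] [InnerProductSpace ℂ K]
    {e : ι → K} (he : DenseRange e) {w : K} {r : ℝ} (hr : 0 ≤ r)
    (h : ∀ i, ‖⟪e i, w⟫_ℂ‖ ≤ ‖e i‖ * r) : ‖w‖ ≤ r := by
  have h1 : ‖⟪w, w⟫_ℂ‖ ≤ ‖w‖ * r :=
    he.induction_on (p := fun v => ‖⟪v, w⟫_ℂ‖ ≤ ‖v‖ * r) w
      (isClosed_le (by fun_prop) (by fun_prop)) h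
  rw [inner_self_eq_norm_sq_to_K, norm_pow, RCLike.norm_ofReal, abs_norm] at h1
  rcases (norm_nonneg w).eq_or_lt with h0 | h0
  · rwa [← h0]
  · nlinarith

/-- For `y ∈ B'`, the functional `a ↦ φ (a ⊙ y* y)` is dominated by `‖y‖² μ`, hence is a vector
functional of the amplified representation, and its vector bounds `E` at `y Λ_ν`. -/
lemma exists_norm_channel_commutantOrbit_le (hφ : φ ∈ gradedPlans μ S ν)
    (hE : ∀ a b, ⟪vec S ν, (E a : G →L[ℂ] G) (commutantOrbit S ν b)⟫_ℂ = φ (a ⊗ₜ[ℂ] b))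
    (y : B.commutant.toStarSubalgebra) :
    ∃ ξ : EllTwo H, ‖ξ‖ = ‖commutantOrbit S ν y‖ ∧
      ∀ a, ‖(E a : G →L[ℂ] G) (commutantOrbit S ν y)‖ ≤ ‖amp (a : H →L[ℂ] H) ξ‖ := by
  obtain ⟨ζ, hζ⟩ := exists_norm_map_star_mul_self_le μ.normal
  obtain ⟨ξ, hξ⟩ := exists_vector_of_dominated
    ((ampHom H).comp A.toStarSubalgebra.subtype) ζ
    (φ := φ ∘ₗ (TensorProduct.mk ℂ A.toStarSubalgebra B.commutant.toStarSubalgebra).flip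
      (star y * y)) (fun a => gradedPlan_nonneg hφ a y) (sq_nonneg ‖(y : G →L[ℂ] G)‖)
    (fun a => (gradedPlan_le_norm_right hφ a y).trans
      (mul_le_mul_of_nonneg_left ((Complex.re_le_norm _).trans (hζ a)) (sq_nonneg _)))
  have hξ' : ∀ a : A.toStarSubalgebra,
      φ (a ⊗ₜ[ℂ] (star y * y)) = ⟪ξ, amp (a : H →L[ℂ] H) ξ⟫_ℂ := hξ
  have hsq : ∀ a : A.toStarSubalgebra,
      (φ ((star a * a) ⊗ₜ[ℂ] (star y * y))).re = ‖amp (a : H →L[ℂ] H) ξ‖ ^ 2 := by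
    intro a
    have hs : ((star a * a : A.toStarSubalgebra) : H →L[ℂ] H) =
      star (a : H →L[ℂ] H) * (a : H →L[ℂ] H) := rfl
    rw [hξ', hs, inner_amp_star_mul, inner_self_eq_norm_sq_to_K]
    norm_cast
  refine ⟨ξ, ?_, fun a => ?_⟩
  · have h1 := hsq 1
    have hs : ((1 : A.toStarSubalgebra) : H →L[ℂ] H) = 1 := rfl
    rw [star_one, one_mul, gradedPlan_re_one_tmul hφ, hs, amp_one, one_apply_eq_self] at h1
    exact ((sq_eq_sq₀ (norm_nonneg _) (norm_nonneg _)).1 h1).symm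
  · refine norm_le_of_denseRange_inner (denseRange_commutantOrbit S ν) (norm_nonneg _) fun b => ?_
    rw [inner_channel hE, ← pow_le_pow_iff_left₀ (norm_nonneg _) (by positivity) two_ne_zero,
      mul_pow, ← hsq]
    exact gradedPlan_norm_sq_le hφ a b y

/-- A vector of `G` is a rapidly convergent series of vectors `y Λ_ν` with `y ∈ B'`, so the bounds
of `exists_norm_channel_commutantOrbit_le` add up to one that is uniform in the norm. -/
lemma exists_norm_channel_le (hφ : φ ∈ gradedPlans μ S ν)
    (hE : ∀ a b, ⟪vec S ν, (E a : G →L[ℂ] G) (commutantOrbit S ν b)⟫_ℂ = φ (a ⊗ₜ[ℂ] b))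
    (y : G) : ∃ ξ : EllTwo H, ‖ξ‖ ^ 2 ≤ 32 * ‖y‖ ^ 2 ∧
      ∀ a, ‖(E a : G →L[ℂ] G) y‖ ≤ ‖amp (a : H →L[ℂ] H) ξ‖ := by
  rcases eq_or_ne y 0 with rfl | hy
  · exact ⟨0, by simp, fun a => by simp⟩
  have hr : 0 < ‖y‖ := norm_pos_iff.2 hy
  obtain ⟨v, hv, hv0, hvn⟩ := controlled_sum_of_mem_closure_range
    (j := (commutantOrbit S ν).toAddMonoidHom) (b := y) (denseRange_commutantOrbit S ν y)
    (f := fun n => ‖y‖ * (1 / 4) ^ n) (fun n => by positivity)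
  have hv' : ∀ n, ‖commutantOrbit S ν (v n)‖ ≤ 2 * ‖y‖ * (1 / 4) ^ n := by
    intro n
    rcases Nat.eq_zero_or_pos n with rfl | hn
    · have h1 : ‖-commutantOrbit S ν (v 0) + y‖ < ‖y‖ * (1 / 4) ^ 0 := hv0
      have h2 := norm_sub_le y (-commutantOrbit S ν (v 0) + y)
      rw [show y - (-commutantOrbit S ν (v 0) + y) = commutantOrbit S ν (v 0) by abel] at h2
      linarith
    · have h1 : ‖commutantOrbit S ν (v n)‖ < ‖y‖ * (1 / 4) ^ n := hvn n hn
      have h2 : 0 < ‖y‖ * (1 / 4 : ℝ) ^ n := by positivity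
      linarith
  choose ξ hξ hξE using exists_norm_channel_commutantOrbit_le hφ hE
  -- the factor `2 ^ (n + 1)` makes room for the Cauchy–Schwarz inequality below
  let η : ℕ → EllTwo H := fun n => (2 ^ (n + 1) : ℂ) • ξ (v n)
  have hη : ∀ n t, ‖amp t (η n)‖ = 2 ^ (n + 1) * ‖amp t (ξ (v n))‖ := fun n t => by
    simp [η, norm_smul]
  have hη1 : ∀ n, ‖η n‖ ^ 2 ≤ 16 * ‖y‖ ^ 2 * (1 / 4) ^ n := by
    intro n
    have h1 : ‖η n‖ = 2 ^ (n + 1) * ‖commutantOrbit S ν (v n)‖ := by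
      simp [η, norm_smul, hξ]
    have h2 : ‖η n‖ ≤ 4 * ‖y‖ * (1 / 2) ^ n := by
      rw [h1]
      calc (2 : ℝ) ^ (n + 1) * ‖commutantOrbit S ν (v n)‖
          ≤ 2 ^ (n + 1) * (2 * ‖y‖ * (1 / 4) ^ n) := by gcongr; exact hv' n
        _ = 4 * ‖y‖ * (2 * (1 / 4)) ^ n := by rw [mul_pow, pow_succ]; ring
        _ = 4 * ‖y‖ * (1 / 2) ^ n := by norm_num
    calc ‖η n‖ ^ 2 ≤ (4 * ‖y‖ * (1 / 2) ^ n) ^ 2 := by gcongr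
      _ = 16 * ‖y‖ ^ 2 * ((1 / 2) ^ 2) ^ n := by rw [← pow_mul, mul_comm 2 n, pow_mul]; ring
      _ = 16 * ‖y‖ ^ 2 * (1 / 4) ^ n := by norm_num
  have hgeom : HasSum (fun n : ℕ => 16 * ‖y‖ ^ 2 * (1 / 4 : ℝ) ^ n)
      (16 * ‖y‖ ^ 2 * (1 - 1 / 4)⁻¹) :=
    (hasSum_geometric_of_lt_one (by norm_num) (by norm_num)).mul_left _
  obtain ⟨Ξ, hΞ⟩ := exists_hasSum_norm_amp_sq
    (Summable.of_nonneg_of_le (fun n => sq_nonneg _) hη1 hgeom.summable)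
  refine ⟨Ξ, ?_, fun a => ?_⟩
  · have h1 := hΞ 1
    simp only [amp_one, one_apply_eq_self] at h1
    have h2 := hasSum_le hη1 h1 hgeom
    norm_num at h2
    nlinarith [sq_nonneg ‖y‖]
  · have hlim : Filter.Tendsto (fun n => ‖(E a : G →L[ℂ] G)
        (∑ i ∈ Finset.range (n + 1), commutantOrbit S ν (v i))‖) Filter.atTop
        (𝓝 ‖(E a : G →L[ℂ] G) y‖) :=
      (((E a : G →L[ℂ] G).continuous.norm).tendsto y).comp hv
    refine le_of_tendsto' hlim fun n => ?_
    rw [← pow_le_pow_iff_left₀ (norm_nonneg _) (norm_nonneg _) two_ne_zero]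
    calc ‖(E a : G →L[ℂ] G) (∑ i ∈ Finset.range (n + 1), commutantOrbit S ν (v i))‖ ^ 2
        ≤ (∑ i ∈ Finset.range (n + 1), (1 / 2) ^ (i + 1) * ‖amp (a : H →L[ℂ] H) (η i)‖) ^ 2 := by
          gcongr
          rw [map_sum]
          refine (norm_sum_le _ _).trans (Finset.sum_le_sum fun i _ => ?_)
          rw [hη, ← mul_assoc, ← mul_pow]
          norm_num
          exact hξE _ a
      _ ≤ (∑ i ∈ Finset.range (n + 1), ((1 / 2 : ℝ) ^ (i + 1)) ^ 2) *
          ∑ i ∈ Finset.range (n + 1), ‖amp (a : H →L[ℂ] H) (η i)‖ ^ 2 :=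
          Finset.sum_mul_sq_le_sq_mul_sq _ _ _
      _ ≤ 1 * ‖amp (a : H →L[ℂ] H) Ξ‖ ^ 2 := by
          refine mul_le_mul ?_ (sum_le_hasSum _ (fun i _ => sq_nonneg _) (hΞ a))
            (Finset.sum_nonneg fun i _ => sq_nonneg _) zero_le_one
          have hg : HasSum (fun i : ℕ => ((1 / 2 : ℝ) ^ (i + 1)) ^ 2)
              (1 / 4 * (1 - 1 / 4)⁻¹) := by
            have h1 := (hasSum_geometric_of_lt_one (r := (1 / 4 : ℝ)) (by norm_num)
              (by norm_num)).mul_left (1 / 4)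
            have h2 : ∀ i : ℕ, ((1 / 2 : ℝ) ^ (i + 1)) ^ 2 = 1 / 4 * (1 / 4) ^ i := fun i => by
              rw [← pow_mul, mul_comm, pow_mul, pow_succ']
              norm_num
            simpa only [h2] using h1
          refine (sum_le_hasSum _ (fun i _ => sq_nonneg _) hg).trans ?_
          norm_num
      _ = ‖amp (a : H →L[ℂ] H) Ξ‖ ^ 2 := one_mul _

/-- The channel is `σ`-weakly continuous: each functional `a ↦ ∑ ⟨xₙ, E(a) yₙ⟩` is bounded by
`a ↦ ‖a Ξ‖` for a vector `Ξ` of the amplified representation, hence represented by a vector. -/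
theorem channel_normal (hφ : φ ∈ gradedPlans μ S ν)
    (hE : ∀ a b, ⟪vec S ν, (E a : G →L[ℂ] G) (commutantOrbit S ν b)⟫_ℂ = φ (a ⊗ₜ[ℂ] b)) :
    Continuous[sigmaWeak A.toStarSubalgebra, sigmaWeak B.toStarSubalgebra] E := by
  refine continuous_iInf_rng.2 fun p => continuous_induced_rng.2 ?_
  let x : EllTwo G := ⟨p.1.1, memℓp_two_iff.2 p.2.1⟩
  let y : EllTwo G := ⟨p.1.2, memℓp_two_iff.2 p.2.2⟩
  choose ξ hξ hξE using exists_norm_channel_le hφ hE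
  obtain ⟨Ξ, hΞ⟩ := exists_hasSum_norm_amp_sq (ξ := fun n => ξ (y n))
    (Summable.of_nonneg_of_le (fun n => sq_nonneg _) (fun n => hξ (y n))
      ((hasSum_norm_sq y).summable.mul_left 32))
  let e : A.toStarSubalgebra →ₗ[ℂ] EllTwo H :=
    { toFun := fun a => amp (a : H →L[ℂ] H) Ξ
      map_add' := fun a b => congrArg (fun t => t Ξ) (map_add (ampHom H) (a : H →L[ℂ] H) b)
      map_smul' := fun r a => congrArg (fun t => t Ξ) (map_smul (ampHom H) r (a : H →L[ℂ] H)) }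
  let f : A.toStarSubalgebra →ₗ[ℂ] ℂ :=
    { toFun := fun a => ⟪x, amp (E a : G →L[ℂ] G) y⟫_ℂ
      map_add' := fun a b => by
        have h : amp ((E (a + b) : B.toStarSubalgebra) : G →L[ℂ] G) =
            amp (E a : G →L[ℂ] G) + amp (E b : G →L[ℂ] G) := by
          rw [map_add]
          exact map_add (ampHom G) (E a : G →L[ℂ] G) (E b)
        rw [h, add_apply, inner_add_right]
      map_smul' := fun r a => by
        have h : amp ((E (r • a) : B.toStarSubalgebra) : G →L[ℂ] G) =
            r • amp (E a : G →L[ℂ] G) := by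
          rw [map_smul]
          exact map_smul (ampHom G) r (E a : G →L[ℂ] G)
        rw [h, smul_apply, inner_smul_right]
        rfl }
  obtain ⟨η, hη⟩ := exists_inner_eq e f (norm_nonneg x) fun a => by
    refine (norm_inner_le_norm _ _).trans (mul_le_mul_of_nonneg_left ?_ (norm_nonneg x))
    rw [← pow_le_pow_iff_left₀ (norm_nonneg _) (norm_nonneg _) two_ne_zero]
    refine hasSum_le (fun n => ?_) (hasSum_norm_sq (amp (E a : G →L[ℂ] G) y)) (hΞ a)
    exact pow_le_pow_left₀ (norm_nonneg _) (hξE (y n) a) 2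
  have hf : (fun b : B.toStarSubalgebra => ∑' n, ⟪p.1.1 n, (b : G →L[ℂ] G) (p.1.2 n)⟫_ℂ) ∘ E =
      fun a : A.toStarSubalgebra => ⟪η, amp (a : H →L[ℂ] H) Ξ⟫_ℂ :=
    funext fun a => (tsum_inner_eq_inner_amp (E a : G →L[ℂ] G) x y).trans (hη a)
  rw [hf]
  exact continuous_sigmaWeak_inner_amp _ η Ξ

end Normality

end FermiOT

open scoped TensorProduct in
theorem corollary5p9 {H : Type*} [NormedAddCommGroup H] [InnerProductSpace ℂ H] [CompleteSpace H]
    {G : Type*} [NormedAddCommGroup G] [InnerProductSpace ℂ G] [CompleteSpace G]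
    (A : VonNeumannAlgebra H) (B : VonNeumannAlgebra G)
    (γA : FermiOT.Grading A.toStarSubalgebra) (γB : FermiOT.Grading B.toStarSubalgebra)
    (S : FermiOT.StandardForm B) (μ : FermiOT.EvenState γA) (ν : FermiOT.EvenState γB)
    (ω : FermiOT.Fermi γA (FermiOT.twistedGrading S ν) →ₗ[ℂ] ℂ)
    (hω : ω ∈ FermiOT.fermionicPlans μ S ν) :
    ∃ E : A.toStarSubalgebra →ₗ[ℂ] B.toStarSubalgebra,
      ω = FermiOT.fermionicDiagonalPlan S ν ∘ₗ
        FermiOT.fermiMap γA (FermiOT.twistedGrading S ν) γB (FermiOT.twistedGrading S ν)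
          E LinearMap.id ∧
      (∀ F : A.toStarSubalgebra → B.toStarSubalgebra,
        (∀ a b, ω (FermiOT.ftmul γA (FermiOT.twistedGrading S ν) a b) =
          FermiOT.fermionicDiagonalPlan S ν
            (FermiOT.ftmul γB (FermiOT.twistedGrading S ν) (F a) b)) → F = E) ∧
      FermiOT.IsChannel E ∧
      Continuous[FermiOT.sigmaWeak A.toStarSubalgebra, FermiOT.sigmaWeak B.toStarSubalgebra] E ∧
      (∀ a, E (γA.aut a) = γB.aut (E a)) ∧
      (∀ a, ν.toLin (E a) = μ.toLin a) ∧
      FermiOT.usualPlan S ν ω ∈ FermiOT.gradedPlans μ S ν ∧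
      FermiOT.usualPlan S ν ω =
        FermiOT.diagonalPlan S ν ∘ₗ TensorProduct.map E LinearMap.id ∧
      (∀ F : A.toStarSubalgebra → B.toStarSubalgebra,
        (∀ a b, FermiOT.usualPlan S ν ω (a ⊗ₜ[ℂ] b) =
          FermiOT.diagonalPlan S ν (F a ⊗ₜ[ℂ] b)) → F = E) := by
  have hφ := FermiOT.usualPlan_mem_gradedPlans hω
  obtain ⟨E, hE⟩ := FermiOT.exists_linearMap_of_gradedPlan hφ
  have hdiag : ∀ (T : B.toStarSubalgebra) (b : B.commutant.toStarSubalgebra),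
      FermiOT.diagonalPlan S ν (T ⊗ₜ[ℂ] b) = inner ℂ (FermiOT.vec S ν)
        ((T : G →L[ℂ] G) (FermiOT.commutantOrbit S ν b)) := fun T b => rfl
  have hfdiag : ∀ (T : B.toStarSubalgebra) (b : B.commutant.toStarSubalgebra),
      FermiOT.fermionicDiagonalPlan S ν
        (FermiOT.ftmul γB (FermiOT.twistedGrading S ν) T (FermiOT.untwist S ν b)) =
      inner ℂ (FermiOT.vec S ν) ((T : G →L[ℂ] G) (FermiOT.commutantOrbit S ν b)) := by
    intro T b
    have h : FermiOT.fermionicDiagonalPlan S ν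
        (FermiOT.ftmul γB (FermiOT.twistedGrading S ν) T (FermiOT.untwist S ν b)) =
      inner ℂ (FermiOT.vec S ν) ((T : G →L[ℂ] G)
        ((FermiOT.untwist S ν b : G →L[ℂ] G) (FermiOT.vec S ν))) := rfl
    rw [h, FermiOT.untwist_vec, FermiOT.commutantOrbit_apply]
  have hωE : ∀ a b, ω (FermiOT.ftmul γA (FermiOT.twistedGrading S ν) a (FermiOT.untwist S ν b)) =
      inner ℂ (FermiOT.vec S ν) ((E a : G →L[ℂ] G) (FermiOT.commutantOrbit S ν b)) := fun a b => by
    rw [hE, FermiOT.usualPlan_tmul]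
  refine ⟨E, ?_, fun F hF => funext fun a => FermiOT.ext_of_inner_vec S ν fun b => ?_,
    ⟨FermiOT.channel_map_one hφ hE, FermiOT.channel_completelyPositive hφ hE⟩,
    FermiOT.channel_normal hφ hE, FermiOT.channel_aut hφ hE, FermiOT.state_channel hφ hE, hφ, ?_,
    fun F hF => funext fun a => FermiOT.ext_of_inner_vec S ν fun b => ?_⟩
  · refine GradedTensorProduct.hom_ext _ _ (TensorProduct.ext' fun a b => ?_)
    obtain ⟨b, rfl⟩ := FermiOT.untwist_surjective S ν b
    exact (hωE a b).trans (hfdiag (E a) b).symm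
  · rw [← hfdiag, ← hF, hωE]
  · exact TensorProduct.ext' fun a b => ((hdiag (E a) b).trans (hE a b)).symm
  · rw [← hdiag, ← hF, hE]
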